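/- All Hilbert spaces are finite-dimensional and nonzero, and $\mathcal{L}(H)$ denotes the linear operators on $H$. For $\alpha>0$ and $X\in\mathcal{L}(H)$ put $\|X\|_\alpha=(\operatorname{tr}|X|^\alpha)^{1/\alpha}$. For $0<\alpha<1$ and a completely positive map $\mathcal{M}:\mathcal{L}(A')\to\mathcal{L}(B)$, the completely bounded $1\to\alpha$ quasi-norm of $\mathcal{M}$ is $$\|\mathcal{M}\|_{\mathrm{cb},1\to\alpha}:=\min_{\varphi_{AA'}}\frac{\|(\mathrm{id}_A\otimes\mathcal{M})(\varphi_{AA'})\|_\alpha}{\|\operatorname{tr}_A\varphi_{AA'}\|_\alpha},$$ where $A\cong A'$ and the minimum is over all pure states (density operators of rank one) $\varphi_{AA'}$ on $A\otimes A'$. **Theorem.** Let $\mathcal{M}_1:\mathcal{L}(A_1')\to\mathcal{L}(B_1)$ and $\mathcal{M}_2:\mathcal{L}(A_2')\to\mathcal{L}(B_2)$ be completely positive maps. For any $\alpha\in[\tfrac12,1)$, the minima defining the three quasi-norms below are attained, and $$\|\mathcal{M}_1\otimes\mathcal{M}_2\|_{\mathrm{cb},1\to\alpha}=\|\mathcal{M}_1\|_{\mathrm{cb},1\to\alpha}\,\|\mathcal{M}_2\|_{\mathrm{cb},1\to\alpha}.$$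 -/

import Mathlib

open scoped Kronecker TensorProduct MatrixOrder Matrix.Norms.L2Operator CStarAlgebra ComplexOrder

/-! A quantum system is a finite-dimensional Hilbert space with a fixed orthonormal basis indexed by
a finite type `a`; linear operators on it are the matrices `Matrix a a ℂ`, with the C⋆-algebra
structure given by the operator norm and the Loewner order. Composite systems are indexed by products,
and completely positive maps are Mathlib's bundled maps `Matrix a a ℂ →CP Matrix b b ℂ`. -/

namespace QuantumCB

/-- The Schatten `α`-(quasi-)norm `‖X‖_α = (Tr |X|^α)^(1/α)` for `α > 0`: the singular values of `X`
are the square roots of the eigenvalues of `Xᴴ X`. -/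
noncomputable def schattenNorm {a : Type*} [Fintype a] [DecidableEq a] (α : ℝ)
    (X : Matrix a a ℂ) : ℝ :=
  (∑ i, (√((Matrix.isHermitian_conjTranspose_mul_self X).eigenvalues i)) ^ α) ^ (1 / α)

/-- The tensor product `M ⊗ N` of two linear maps between matrix algebras, transported along
`Matrix a a ℂ ⊗ Matrix b b ℂ ≃ Matrix (a × b) (a × b) ℂ`. -/
noncomputable def mapTensor {a b c d : Type*} [Fintype a] [DecidableEq a] [Fintype b] [DecidableEq b]
    [Fintype c] [DecidableEq c] [Fintype d] [DecidableEq d]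
    (M : Matrix a a ℂ →ₗ[ℂ] Matrix b b ℂ) (N : Matrix c c ℂ →ₗ[ℂ] Matrix d d ℂ) :
    Matrix (a × c) (a × c) ℂ →ₗ[ℂ] Matrix (b × d) (b × d) ℂ :=
  (kroneckerLinearEquiv b b d d ℂ).toLinearMap ∘ₗ TensorProduct.map M N ∘ₗ
    (kroneckerLinearEquiv a a c c ℂ).symm.toLinearMap

/-- The partial trace over the first tensor factor. -/
def traceLeft {a b : Type*} [Fintype a] (X : Matrix (a × b) (a × b) ℂ) : Matrix b b ℂ :=
  Matrix.of fun i j => ∑ k, X (k, i) (k, j)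

/-- Pure states: density operators (positive semidefinite, of trace one) of rank one. -/
def IsPureState {a : Type*} [Fintype a] (φ : Matrix a a ℂ) : Prop :=
  φ.PosSemidef ∧ φ.trace = 1 ∧ φ.rank = 1

/-- The set of all values `‖(id_A ⊗ M)(φ)‖_α / ‖tr_A φ‖_α`, where `φ` runs over the pure states
of `A ⊗ A'`, and the reference system `A` is a copy of the input system `A'` of `M`. -/
def cbRatios {a b : Type*} [Fintype a] [DecidableEq a] [Fintype b] [DecidableEq b] (α : ℝ)
    (M : Matrix a a ℂ →ₗ[ℂ] Matrix b b ℂ) : Set ℝ :=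
  {r | ∃ φ : Matrix (a × a) (a × a) ℂ, IsPureState φ ∧
    r = schattenNorm α (mapTensor (LinearMap.id : Matrix a a ℂ →ₗ[ℂ] Matrix a a ℂ) M φ) /
      schattenNorm α (traceLeft φ)}

/-- The completely bounded `1 → α` quasi-norm of `M`: the least element of `cbRatios α M`. -/
noncomputable def cbQuasiNorm {a b : Type*} [Fintype a] [DecidableEq a] [Fintype b] [DecidableEq b]
    (α : ℝ) (M : Matrix a a ℂ →ₗ[ℂ] Matrix b b ℂ) : ℝ :=
  sInf (cbRatios α M)

end QuantumCB

namespace QuantumCB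

set_option linter.unusedSectionVars false

open Matrix

/-! Up to transposes, the two marginal operators of a purified output have equal nonzero spectra. So
the ratio for a pure state with marginal `σ` is `(Tr Φ(σ)^α / Tr σ^α)^(1/α)`, where `Φ = krausMap K`
is a map complementary to `M`, and the claim becomes multiplicativity of the minimum of `Tr Φ(σ)^α /
Tr σ^α`. Product operators give `≤`; the content is `≥`.

Put `p = 1/α ∈ (1, 2]` and `τ = σ^(1/p)`. By the reverse Hölder inequality (`klein_mpow_inv`,
`powTr_rpow_le`), `Tr Φ(τ^p)^(1/p)` is governed by the minimisation over `Z` of `F(τ, Z) = Tr Φ(τ^p)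
Z^(1-p)`. By Ando's theorem (`andoForm_add_le`) `F` is subadditive, and it is homogeneous of degree
one, hence jointly convex. A positive definite critical point is therefore a global minimiser
(`tangent_le_trace_krausMap`, `le_powTr_krausMap_of_critical`). The critical equations are
identities between matrix powers, so the tensor product of two critical points is critical for the
tensor product map.

Minimisers could be singular, where this argument fails. The denominator is therefore replaced by
`(Tr σ^γ)^(α/γ)` with `γ < α`: filling a kernel direction with weight `t` raises the denominator at
order `t^γ` but the numerator at order at most `t^α`, so minimisers have full rank
(`posDef_of_isMin`) and satisfy the critical equations (`exists_critical_point`). Dimension factors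
control the replacement and tend to one as `γ → α` (`mul_mul_le_powTr_krausTensor`). -/

/-- `A = U diag(d) Uᴴ` with `U` unitary and `d` real. -/
def IsSpectral {n : Type*} [Fintype n] [DecidableEq n] (A U : Matrix n n ℂ) (d : n → ℝ) : Prop :=
  Uᴴ * U = 1 ∧ A = U * diagonal (fun i => (d i : ℂ)) * Uᴴ

/-- The functional calculus of Hermitian matrices (zero for other matrices). -/
noncomputable def funcCalc {n : Type*} [Fintype n] [DecidableEq n] (f : ℝ → ℝ)
    (A : Matrix n n ℂ) : Matrix n n ℂ :=
  open Classical in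
  if h : A.IsHermitian then
    (h.eigenvectorUnitary : Matrix n n ℂ) * diagonal (fun i => (f (h.eigenvalues i) : ℂ)) *
      (h.eigenvectorUnitary : Matrix n n ℂ)ᴴ
  else 0

/-! ### Spectral calculus, overlaps of eigenbases, real powers and their traces. -/

section Spectral

variable {n m : Type*} [Fintype n] [DecidableEq n] [Fintype m] [DecidableEq m]

theorem IsSpectral.mul_conjTranspose {A U : Matrix n n ℂ} {d : n → ℝ} (h : IsSpectral A U d) :
    U * Uᴴ = 1 := mul_eq_one_comm.mp h.1

theorem isSpectral_eigenvalues {A : Matrix n n ℂ} (h : A.IsHermitian) :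
    IsSpectral A (h.eigenvectorUnitary : Matrix n n ℂ) h.eigenvalues := by
  refine ⟨?_, ?_⟩
  · have := (Matrix.mem_unitaryGroup_iff').1 h.eigenvectorUnitary.2
    simpa [star_eq_conjTranspose] using this
  · have := h.spectral_theorem
    rw [Unitary.conjStarAlgAut_apply] at this
    exact this

theorem IsSpectral.isHermitian {A U : Matrix n n ℂ} {d : n → ℝ} (h : IsSpectral A U d) :
    A.IsHermitian := by
  rw [h.2, IsHermitian, conjTranspose_mul, conjTranspose_mul, diagonal_conjTranspose,
    conjTranspose_conjTranspose, Matrix.mul_assoc]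
  congr 3
  ext i
  simp

theorem IsSpectral.conj_eq {A U : Matrix n n ℂ} {d : n → ℝ} (h : IsSpectral A U d) :
    Uᴴ * A = diagonal (fun i => (d i : ℂ)) * Uᴴ := by
  rw [h.2, ← Matrix.mul_assoc, ← Matrix.mul_assoc, h.1, Matrix.one_mul]

theorem IsSpectral.mul_eq {A U : Matrix n n ℂ} {d : n → ℝ} (h : IsSpectral A U d) :
    A * U = U * diagonal (fun i => (d i : ℂ)) := by
  rw [h.2, Matrix.mul_assoc, h.1, Matrix.mul_one]

/-- `Vᴴ * U` intertwines the two diagonal matrices, so its nonzero entries link only equal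
eigenvalues, and it also intertwines their images under `f`. Hence any diagonalisation computes the
functional calculus. -/
theorem funcCalc_eq {A U : Matrix n n ℂ} {d : n → ℝ} (h : IsSpectral A U d) (f : ℝ → ℝ) :
    funcCalc f A = U * diagonal (fun i => (f (d i) : ℂ)) * Uᴴ := by
  have hA := h.isHermitian
  have hV := isSpectral_eigenvalues hA
  rw [funcCalc, dif_pos hA]
  set V : Matrix n n ℂ := (hA.eigenvectorUnitary : Matrix n n ℂ)
  set e := hA.eigenvalues
  have key : diagonal (fun i => (e i : ℂ)) * (Vᴴ * U) = (Vᴴ * U) * diagonal (fun i => (d i : ℂ)) := by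
    rw [← Matrix.mul_assoc, ← hV.conj_eq, Matrix.mul_assoc, h.mul_eq, Matrix.mul_assoc]
  have key2 : diagonal (fun i => (f (e i) : ℂ)) * (Vᴴ * U) =
      (Vᴴ * U) * diagonal (fun i => (f (d i) : ℂ)) := by
    ext i j
    have hij := congrFun (congrFun key i) j
    rw [diagonal_mul, mul_diagonal] at hij ⊢
    by_cases h0 : (Vᴴ * U) i j = 0
    · simp [h0]
    · have : (e i : ℂ) = d j := by
        rw [mul_comm] at hij
        exact mul_left_cancel₀ h0 hij
      have : e i = d j := by exact_mod_cast this
      rw [this, mul_comm]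
  calc V * diagonal (fun i => (f (e i) : ℂ)) * Vᴴ
      = V * (diagonal (fun i => (f (e i) : ℂ)) * (Vᴴ * U)) * Uᴴ := by
        simp only [Matrix.mul_assoc, h.mul_conjTranspose, Matrix.mul_one]
    _ = U * diagonal (fun i => (f (d i) : ℂ)) * Uᴴ := by
        rw [key2]
        simp only [← Matrix.mul_assoc, hV.mul_conjTranspose, Matrix.one_mul]

theorem IsSpectral.funcCalc {A U : Matrix n n ℂ} {d : n → ℝ} (h : IsSpectral A U d) (f : ℝ → ℝ) :
    IsSpectral (funcCalc f A) U (fun i => f (d i)) := ⟨h.1, funcCalc_eq h f⟩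

theorem IsSpectral.trace {A U : Matrix n n ℂ} {d : n → ℝ} (h : IsSpectral A U d) :
    A.trace = ((∑ i, d i : ℝ) : ℂ) := by
  rw [h.2, trace_mul_comm, ← Matrix.mul_assoc, h.1, Matrix.one_mul, trace_diagonal]
  push_cast
  rfl

theorem IsSpectral.smul {A U : Matrix n n ℂ} {d : n → ℝ} (h : IsSpectral A U d) (c : ℝ) :
    IsSpectral ((c : ℂ) • A) U (fun i => c * d i) := by
  refine ⟨h.1, ?_⟩
  have : diagonal (fun i => ((c * d i : ℝ) : ℂ)) = (c : ℂ) • diagonal (fun i => (d i : ℂ)) := by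
    ext i j
    simp [diagonal_apply]
  rw [this, h.2, Matrix.mul_smul, Matrix.smul_mul]

theorem IsSpectral.kronecker {A U : Matrix n n ℂ} {d : n → ℝ} {B V : Matrix m m ℂ} {e : m → ℝ}
    (h : IsSpectral A U d) (h' : IsSpectral B V e) :
    IsSpectral (A ⊗ₖ B) (U ⊗ₖ V) (fun i => d i.1 * e i.2) := by
  refine ⟨?_, ?_⟩
  · rw [conjTranspose_kronecker, ← mul_kronecker_mul, h.1, h'.1, one_kronecker_one]
  · rw [conjTranspose_kronecker]
    have : diagonal (fun i : n × m => ((d i.1 * e i.2 : ℝ) : ℂ)) =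
        diagonal (fun i => (d i : ℂ)) ⊗ₖ diagonal (fun i => (e i : ℂ)) := by
      rw [diagonal_kronecker_diagonal]
      simp
    rw [this, ← mul_kronecker_mul, ← mul_kronecker_mul, ← h.2, ← h'.2]

theorem IsSpectral.apply_eq {A U : Matrix n n ℂ} {d : n → ℝ} (h : IsSpectral A U d) (i : n) :
    (d i : ℂ) = star (U.col i) ⬝ᵥ A *ᵥ U.col i := by
  have h1 : (Uᴴ * A * U) i i = d i := by
    rw [h.conj_eq, Matrix.mul_assoc, h.1, Matrix.mul_one, diagonal_apply_eq]
  rw [← h1, Matrix.mul_assoc, Matrix.mul_apply]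
  simp [dotProduct, mulVec, Matrix.mul_apply]

theorem IsSpectral.col_ne_zero {A U : Matrix n n ℂ} {d : n → ℝ} (h : IsSpectral A U d) (i : n) :
    U.col i ≠ 0 := by
  intro h0
  have h1 : (Uᴴ * U) i i = 1 := by rw [h.1]; simp
  rw [Matrix.mul_apply] at h1
  have : ∀ j, U j i = 0 := fun j => congrFun h0 j
  simp [this] at h1

theorem IsSpectral.nonneg {A U : Matrix n n ℂ} {d : n → ℝ} (h : IsSpectral A U d)
    (hA : A.PosSemidef) (i : n) : 0 ≤ d i := by
  have := hA.dotProduct_mulVec_nonneg (U.col i)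
  rw [← h.apply_eq] at this
  exact_mod_cast this

theorem IsSpectral.pos {A U : Matrix n n ℂ} {d : n → ℝ} (h : IsSpectral A U d)
    (hA : A.PosDef) (i : n) : 0 < d i := by
  have := hA.dotProduct_mulVec_pos (h.col_ne_zero i)
  rw [← h.apply_eq] at this
  exact_mod_cast this

theorem IsSpectral.posSemidef {A U : Matrix n n ℂ} {d : n → ℝ} (h : IsSpectral A U d)
    (hd : ∀ i, 0 ≤ d i) : A.PosSemidef := by
  rw [h.2]
  refine PosSemidef.mul_mul_conjTranspose_same (PosSemidef.diagonal ?_) U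
  intro i
  simpa using hd i

theorem IsSpectral.posDef {A U : Matrix n n ℂ} {d : n → ℝ} (h : IsSpectral A U d)
    (hd : ∀ i, 0 < d i) : A.PosDef := by
  rw [h.2]
  refine PosDef.mul_mul_conjTranspose_same (PosDef.diagonal ?_) ?_
  · intro i
    simpa using hd i
  · intro x y hxy
    have h1 : (x ᵥ* U) ᵥ* Uᴴ = (y ᵥ* U) ᵥ* Uᴴ := congrArg (fun v => v ᵥ* Uᴴ) hxy
    rwa [vecMul_vecMul, vecMul_vecMul, h.mul_conjTranspose, vecMul_one, vecMul_one] at h1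

/-- Every Hermitian matrix has a spectral decomposition. -/
theorem exists_isSpectral {A : Matrix n n ℂ} (h : A.IsHermitian) :
    ∃ U d, IsSpectral A U d := ⟨_, _, isSpectral_eigenvalues h⟩

theorem trace_mul_funcCalc_mul {A U : Matrix n n ℂ} {d : n → ℝ} {B V : Matrix m m ℂ} {e : m → ℝ}
    (h : IsSpectral A U d) (h' : IsSpectral B V e) (X : Matrix n m ℂ) :
    (Xᴴ * A * X * B).trace =
      ((∑ i, ∑ k, d i * e k * Complex.normSq ((Uᴴ * X * V) i k) : ℝ) : ℂ) := by
  have h1 : (Xᴴ * A * X * B).trace = ((Uᴴ * X * V)ᴴ * diagonal (fun i => (d i : ℂ)) *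
      (Uᴴ * X * V) * diagonal (fun i => (e i : ℂ))).trace := by
    rw [h.2, h'.2, ← Matrix.mul_assoc, ← Matrix.mul_assoc, trace_mul_comm]
    simp only [conjTranspose_mul, conjTranspose_conjTranspose, Matrix.mul_assoc]
  rw [h1, trace, Finset.sum_comm]
  push_cast
  refine Finset.sum_congr rfl fun k _ => ?_
  rw [diag_apply, mul_diagonal, Matrix.mul_apply, Finset.sum_mul]
  refine Finset.sum_congr rfl fun i _ => ?_
  rw [mul_diagonal, conjTranspose_apply, Complex.normSq_eq_conj_mul_self]
  simp only [RCLike.star_def]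
  ring

/-- The squared overlaps of two orthonormal bases. -/
noncomputable def overlap (U V : Matrix n n ℂ) (i k : n) : ℝ := Complex.normSq ((Uᴴ * V) i k)

theorem overlap_nonneg (U V : Matrix n n ℂ) (i k : n) : 0 ≤ overlap U V i k :=
  Complex.normSq_nonneg _

theorem trace_mul_eq_sum_overlap {A U : Matrix n n ℂ} {d : n → ℝ} {B V : Matrix n n ℂ} {e : n → ℝ}
    (h : IsSpectral A U d) (h' : IsSpectral B V e) :
    (A * B).trace = ((∑ i, ∑ k, d i * e k * overlap U V i k : ℝ) : ℂ) := by
  have := trace_mul_funcCalc_mul h h' (1 : Matrix n n ℂ)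
  simpa [overlap] using this

theorem sum_overlap_left {A U : Matrix n n ℂ} {d : n → ℝ} {B V : Matrix n n ℂ} {e : n → ℝ}
    (h : IsSpectral A U d) (h' : IsSpectral B V e) (i : n) : ∑ k, overlap U V i k = 1 := by
  have h1 : ((Uᴴ * V) * (Uᴴ * V)ᴴ) i i = 1 := by
    rw [conjTranspose_mul, conjTranspose_conjTranspose, Matrix.mul_assoc, ← Matrix.mul_assoc V,
      h'.mul_conjTranspose, Matrix.one_mul, h.1, one_apply_eq]
  rw [Matrix.mul_apply] at h1
  have h2 : ((∑ k, overlap U V i k : ℝ) : ℂ) = 1 := by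
    rw [← h1]
    push_cast
    refine Finset.sum_congr rfl fun k _ => ?_
    rw [overlap, Complex.normSq_eq_conj_mul_self, conjTranspose_apply, mul_comm]
    rfl
  exact_mod_cast h2

theorem sum_overlap_right {A U : Matrix n n ℂ} {d : n → ℝ} {B V : Matrix n n ℂ} {e : n → ℝ}
    (h : IsSpectral A U d) (h' : IsSpectral B V e) (k : n) : ∑ i, overlap U V i k = 1 := by
  rw [← sum_overlap_left h' h k]
  refine Finset.sum_congr rfl fun i _ => ?_
  have : (Vᴴ * U) k i = star ((Uᴴ * V) i k) := by
    rw [← conjTranspose_apply, conjTranspose_mul, conjTranspose_conjTranspose]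
  rw [overlap, overlap, this, RCLike.star_def, Complex.normSq_conj]

/-- Overlaps form a doubly stochastic matrix. Single-spectrum sums thus become double sums with the
same weights as `trace_mul_eq_sum_overlap`, and scalar inequalities between `d i` and `e k` lift to
traces. -/
theorem sum_sum_left_mul_overlap {A U : Matrix n n ℂ} {d : n → ℝ} {B V : Matrix n n ℂ} {e : n → ℝ}
    (h : IsSpectral A U d) (h' : IsSpectral B V e) (f : n → ℝ) :
    ∑ i, ∑ k, f i * overlap U V i k = ∑ i, f i := by
  refine Finset.sum_congr rfl fun i _ => ?_
  rw [← Finset.mul_sum, sum_overlap_left h h', mul_one]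

theorem sum_sum_right_mul_overlap {A U : Matrix n n ℂ} {d : n → ℝ} {B V : Matrix n n ℂ} {e : n → ℝ}
    (h : IsSpectral A U d) (h' : IsSpectral B V e) (f : n → ℝ) :
    ∑ i, ∑ k, f k * overlap U V i k = ∑ k, f k := by
  rw [Finset.sum_comm]
  refine Finset.sum_congr rfl fun i _ => ?_
  rw [← Finset.mul_sum, sum_overlap_right h h', mul_one]

/-- The squared Hilbert–Schmidt norm. -/
noncomputable def hsSq (X : Matrix n n ℂ) : ℝ := ∑ i, ∑ j, Complex.normSq (X i j)

theorem trace_conjTranspose_mul_self_eq_hsSq (X : Matrix n n ℂ) :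
    (Xᴴ * X).trace = (hsSq X : ℂ) := by
  rw [trace, hsSq, Finset.sum_comm]
  push_cast
  refine Finset.sum_congr rfl fun k _ => ?_
  rw [diag_apply, Matrix.mul_apply]
  refine Finset.sum_congr rfl fun i _ => ?_
  rw [conjTranspose_apply, Complex.normSq_eq_conj_mul_self]
  rfl

/-- The entries of `A - B` between the two eigenbases are `(d i - e k)` times those of `Uᴴ * V`.
This transfers scalar Lipschitz bounds, continuity bounds and equality cases to noncommuting
matrices. -/
theorem hsSq_sub_eq_sum_overlap {A U : Matrix n n ℂ} {d : n → ℝ} {B V : Matrix n n ℂ} {e : n → ℝ}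
    (h : IsSpectral A U d) (h' : IsSpectral B V e) :
    hsSq (A - B) = ∑ i, ∑ k, (d i - e k) ^ 2 * overlap U V i k := by
  have h1 : hsSq (A - B) = hsSq (Uᴴ * (A - B) * V) := by
    have : ((hsSq (A - B) : ℝ) : ℂ) = (hsSq (Uᴴ * (A - B) * V) : ℝ) := by
      rw [← trace_conjTranspose_mul_self_eq_hsSq, ← trace_conjTranspose_mul_self_eq_hsSq]
      simp only [conjTranspose_mul, conjTranspose_conjTranspose, Matrix.mul_assoc]
      rw [trace_mul_comm Vᴴ]
      simp only [Matrix.mul_assoc, h'.mul_conjTranspose, Matrix.mul_one]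
      rw [← Matrix.mul_assoc U, h.mul_conjTranspose, Matrix.one_mul]
    exact_mod_cast this
  rw [h1, hsSq]
  refine Finset.sum_congr rfl fun i _ => Finset.sum_congr rfl fun k _ => ?_
  have : (Uᴴ * (A - B) * V) i k = ((d i - e k : ℝ) : ℂ) * (Uᴴ * V) i k := by
    have h2 : Uᴴ * (A - B) * V = diagonal (fun i => (d i : ℂ)) * (Uᴴ * V) -
        (Uᴴ * V) * diagonal (fun i => (e i : ℂ)) := by
      rw [Matrix.mul_sub, Matrix.sub_mul, h.conj_eq, Matrix.mul_assoc Uᴴ B V, h'.mul_eq,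
        Matrix.mul_assoc, ← Matrix.mul_assoc Uᴴ V]
    rw [h2, Matrix.sub_apply, diagonal_mul, mul_diagonal]
    push_cast
    ring
  rw [this, map_mul, Complex.normSq_ofReal, overlap]
  ring

theorem norm_apply_le_sqrt_hsSq (X : Matrix n n ℂ) (i j : n) : ‖X i j‖ ≤ √(hsSq X) := by
  refine Real.le_sqrt_of_sq_le ?_
  rw [← Complex.normSq_eq_norm_sq, hsSq]
  refine le_trans ?_ (Finset.single_le_sum (f := fun i => ∑ j, Complex.normSq (X i j))
    (fun _ _ => Finset.sum_nonneg fun _ _ => Complex.normSq_nonneg _) (Finset.mem_univ i))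
  exact Finset.single_le_sum (f := fun j => Complex.normSq (X i j))
    (fun _ _ => Complex.normSq_nonneg _) (Finset.mem_univ j)

theorem hsSq_eq_zero {X : Matrix n n ℂ} (h : hsSq X = 0) : X = 0 := by
  ext i j
  have := norm_apply_le_sqrt_hsSq X i j
  rw [h, Real.sqrt_zero] at this
  simpa using norm_le_zero_iff.1 this

/-- The real power of a positive semidefinite matrix. -/
noncomputable def mpow (A : Matrix n n ℂ) (s : ℝ) : Matrix n n ℂ := funcCalc (fun x => x ^ s) A

/-- `Tr A^s`. -/
noncomputable def powTr (s : ℝ) (A : Matrix n n ℂ) : ℝ := (mpow A s).trace.re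

theorem IsSpectral.mpow {A U : Matrix n n ℂ} {d : n → ℝ} (h : IsSpectral A U d) (s : ℝ) :
    IsSpectral (mpow A s) U (fun i => d i ^ s) := h.funcCalc _

theorem IsSpectral.powTr {A U : Matrix n n ℂ} {d : n → ℝ} (h : IsSpectral A U d) (s : ℝ) :
    powTr s A = ∑ i, d i ^ s := by
  rw [QuantumCB.powTr, (h.mpow s).trace, Complex.ofReal_re]

theorem IsSpectral.eq {A B U : Matrix n n ℂ} {d : n → ℝ} (h : IsSpectral A U d)
    (h' : IsSpectral B U d) : A = B := h.2.trans h'.2.symm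

theorem mpow_posSemidef {A : Matrix n n ℂ} (hA : A.PosSemidef) (s : ℝ) :
    (mpow A s).PosSemidef := by
  obtain ⟨U, d, h⟩ := exists_isSpectral hA.isHermitian
  exact (h.mpow s).posSemidef fun i => Real.rpow_nonneg (h.nonneg hA i) s

theorem mpow_posDef {A : Matrix n n ℂ} (hA : A.PosDef) (s : ℝ) : (mpow A s).PosDef := by
  obtain ⟨U, d, h⟩ := exists_isSpectral hA.isHermitian
  exact (h.mpow s).posDef fun i => Real.rpow_pos_of_pos (h.pos hA i) s

theorem mpow_mpow {A : Matrix n n ℂ} (hA : A.PosSemidef) (s t : ℝ) :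
    mpow (mpow A s) t = mpow A (s * t) := by
  obtain ⟨U, d, h⟩ := exists_isSpectral hA.isHermitian
  have h1 := (h.mpow s).mpow t
  have h2 := h.mpow (s * t)
  simp only [← Real.rpow_mul (h.nonneg hA _)] at h1
  exact h1.eq h2

theorem mpow_one {A : Matrix n n ℂ} (hA : A.PosSemidef) : mpow A 1 = A := by
  obtain ⟨U, d, h⟩ := exists_isSpectral hA.isHermitian
  have h1 := h.mpow 1
  simp only [Real.rpow_one] at h1
  exact h1.eq h

theorem mpow_mul_mpow {A : Matrix n n ℂ} (hA : A.PosDef) (s t : ℝ) :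
    mpow A s * mpow A t = mpow A (s + t) := by
  obtain ⟨U, d, h⟩ := exists_isSpectral hA.isHermitian
  have hD : (diagonal fun i => ((d i ^ s : ℝ) : ℂ)) * (diagonal fun i => ((d i ^ t : ℝ) : ℂ)) =
      diagonal fun i => ((d i ^ (s + t) : ℝ) : ℂ) := by
    rw [diagonal_mul_diagonal]
    congr 1
    ext i
    rw [Real.rpow_add (h.pos hA i)]
    push_cast
    rfl
  rw [(h.mpow s).2, (h.mpow t).2, (h.mpow (s + t)).2, ← hD]
  simp only [Matrix.mul_assoc]
  rw [← Matrix.mul_assoc Uᴴ U, h.1, Matrix.one_mul]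

theorem mpow_smul {A : Matrix n n ℂ} (hA : A.PosSemidef) {c : ℝ} (hc : 0 ≤ c) (s : ℝ) :
    mpow ((c : ℂ) • A) s = ((c ^ s : ℝ) : ℂ) • mpow A s := by
  obtain ⟨U, d, h⟩ := exists_isSpectral hA.isHermitian
  have h1 := (h.smul c).mpow s
  simp only [Real.mul_rpow hc (h.nonneg hA _)] at h1
  exact h1.eq ((h.mpow s).smul _)

theorem powTr_smul {A : Matrix n n ℂ} (hA : A.PosSemidef) {c : ℝ} (hc : 0 ≤ c) (s : ℝ) :
    powTr s ((c : ℂ) • A) = c ^ s * powTr s A := by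
  rw [powTr, mpow_smul hA hc, trace_smul, powTr, smul_eq_mul, Complex.re_ofReal_mul]

theorem IsSpectral.congr {A U : Matrix n n ℂ} {d e : n → ℝ} (h : IsSpectral A U d)
    (hd : ∀ i, d i = e i) : IsSpectral A U e := funext hd ▸ h

theorem mpow_kronecker {A : Matrix n n ℂ} {B : Matrix m m ℂ} (hA : A.PosSemidef)
    (hB : B.PosSemidef) (s : ℝ) : mpow (A ⊗ₖ B) s = mpow A s ⊗ₖ mpow B s := by
  obtain ⟨U, d, h⟩ := exists_isSpectral hA.isHermitian
  obtain ⟨V, e, h'⟩ := exists_isSpectral hB.isHermitian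
  have h1 := ((h.kronecker h').mpow s).congr
    fun i => Real.mul_rpow (h.nonneg hA i.1) (h'.nonneg hB i.2)
  have h3 := (h.mpow s).kronecker (h'.mpow s)
  exact h1.2.trans h3.2.symm

theorem powTr_kronecker {A : Matrix n n ℂ} {B : Matrix m m ℂ} (hA : A.PosSemidef)
    (hB : B.PosSemidef) (s : ℝ) : powTr s (A ⊗ₖ B) = powTr s A * powTr s B := by
  obtain ⟨U, d, h⟩ := exists_isSpectral hA.isHermitian
  obtain ⟨V, e, h'⟩ := exists_isSpectral hB.isHermitian
  rw [QuantumCB.powTr, mpow_kronecker hA hB, trace_kronecker, (h.mpow s).trace, (h'.mpow s).trace,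
    h.powTr, h'.powTr, ← Complex.ofReal_mul, Complex.ofReal_re]

theorem powTr_nonneg {A : Matrix n n ℂ} (hA : A.PosSemidef) (s : ℝ) : 0 ≤ powTr s A := by
  obtain ⟨U, d, h⟩ := exists_isSpectral hA.isHermitian
  rw [h.powTr]
  exact Finset.sum_nonneg fun i _ => Real.rpow_nonneg (h.nonneg hA i) s

theorem powTr_pos {A : Matrix n n ℂ} (hA : A.PosSemidef) (hA0 : A ≠ 0) (s : ℝ) :
    0 < powTr s A := by
  obtain ⟨U, d, h⟩ := exists_isSpectral hA.isHermitian
  rw [h.powTr]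
  have : ∃ i, d i ≠ 0 := by
    by_contra! hd
    apply hA0
    rw [h.2]
    simp [hd]
  obtain ⟨i, hi⟩ := this
  exact Finset.sum_pos' (fun i _ => Real.rpow_nonneg (h.nonneg hA i) s)
    ⟨i, Finset.mem_univ _, Real.rpow_pos_of_pos (lt_of_le_of_ne (h.nonneg hA i) (Ne.symm hi)) s⟩

theorem powTr_mpow {A : Matrix n n ℂ} (hA : A.PosSemidef) (s t : ℝ) :
    powTr t (mpow A s) = powTr (s * t) A := by
  rw [powTr, mpow_mpow hA, powTr]

theorem powTr_one {A : Matrix n n ℂ} (hA : A.PosSemidef) : powTr 1 A = A.trace.re := by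
  rw [powTr, mpow_one hA]

theorem powTr_zero {s : ℝ} (hs : s ≠ 0) : powTr s (0 : Matrix n n ℂ) = 0 := by
  obtain ⟨U, d, h⟩ := exists_isSpectral (isHermitian_zero (n := n) (α := ℂ))
  have h1 := h.smul 0
  simp only [smul_zero, zero_mul] at h1
  rw [h1.powTr]
  simp [Real.zero_rpow hs]

end Spectral

/-! ### Klein's inequality and the reverse Hölder inequality, with equality case. -/

section ReverseHolder

/-- The tangent inequality of the jointly convex function `x ^ p * y ^ (1 - p)` on the diagonal. -/
theorem tangent_le_rpow_mul_rpow {p x y : ℝ} (hp : 1 ≤ p) (hx : 0 ≤ x) (hy : 0 < y) :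
    p * x + (1 - p) * y ≤ x ^ p * y ^ (1 - p) := by
  -- Bernoulli's inequality at `x / y - 1`; multiplying by `y` gives the homogeneous form.
  have h := one_add_mul_self_le_rpow_one_add (s := x / y - 1)
    (by linarith [div_nonneg hx hy.le]) hp
  rw [add_sub_cancel, Real.div_rpow hx hy.le] at h
  have h2 := mul_le_mul_of_nonneg_right h hy.le
  have e1 : x ^ p / y ^ p * y = x ^ p * y ^ (1 - p) := by
    rw [Real.rpow_sub hy, Real.rpow_one]
    ring
  rw [e1] at h2
  refine le_trans (le_of_eq ?_) h2
  field_simp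
  ring

theorem tangent_lt_rpow_mul_rpow {p x y : ℝ} (hp : 1 < p) (hx : 0 ≤ x) (hy : 0 < y)
    (hxy : x ≠ y) : p * x + (1 - p) * y < x ^ p * y ^ (1 - p) := by
  have h := one_add_mul_self_lt_rpow_one_add (s := x / y - 1)
    (by linarith [div_nonneg hx hy.le])
    (by rw [sub_ne_zero, Ne, div_eq_one_iff_eq hy.ne']; exact hxy) hp
  rw [add_sub_cancel, Real.div_rpow hx hy.le] at h
  have h2 := mul_lt_mul_of_pos_right h hy
  have e1 : x ^ p / y ^ p * y = x ^ p * y ^ (1 - p) := by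
    rw [Real.rpow_sub hy, Real.rpow_one]
    ring
  rw [e1] at h2
  refine lt_of_le_of_lt (le_of_eq ?_) h2
  field_simp
  ring

variable {n : Type*} [Fintype n] [DecidableEq n]

theorem IsSpectral.trace_re {A U : Matrix n n ℂ} {d : n → ℝ} (h : IsSpectral A U d) :
    A.trace.re = ∑ i, d i := by rw [h.trace, Complex.ofReal_re]

theorem trace_mul_re_nonneg {A B : Matrix n n ℂ} (hA : A.PosSemidef) (hB : B.PosSemidef) :
    0 ≤ (A * B).trace.re := by
  obtain ⟨U, d, h⟩ := exists_isSpectral hA.isHermitian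
  obtain ⟨V, e, h'⟩ := exists_isSpectral hB.isHermitian
  rw [trace_mul_eq_sum_overlap h h', Complex.ofReal_re]
  exact Finset.sum_nonneg fun i _ => Finset.sum_nonneg fun k _ =>
    mul_nonneg (mul_nonneg (h.nonneg hA i) (h'.nonneg hB k)) (overlap_nonneg _ _ _ _)

/-- Klein's inequality for the function `x ^ p`, with weight `Z ^ (q - p)`. -/
theorem klein_mpow {A Z : Matrix n n ℂ} (hA : A.PosSemidef) (hZ : Z.PosDef) {p : ℝ}
    (hp : 1 ≤ p) (q : ℝ) :
    p * (A * mpow Z (q - 1)).trace.re + (1 - p) * powTr q Z ≤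
      (mpow A p * mpow Z (q - p)).trace.re := by
  obtain ⟨U, d, h⟩ := exists_isSpectral hA.isHermitian
  obtain ⟨V, e, h'⟩ := exists_isSpectral hZ.isHermitian
  rw [trace_mul_eq_sum_overlap h (h'.mpow _), trace_mul_eq_sum_overlap (h.mpow _) (h'.mpow _),
    h'.powTr, ← sum_sum_right_mul_overlap h h' (fun k => e k ^ q), Complex.ofReal_re, Complex.ofReal_re,
    Finset.mul_sum, Finset.mul_sum, ← Finset.sum_add_distrib]
  refine Finset.sum_le_sum fun i _ => ?_
  rw [Finset.mul_sum, Finset.mul_sum, ← Finset.sum_add_distrib]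
  refine Finset.sum_le_sum fun k _ => ?_
  have he := h'.pos hZ k
  have h1 := mul_le_mul_of_nonneg_right (tangent_le_rpow_mul_rpow hp (h.nonneg hA i) he)
    (mul_nonneg (Real.rpow_nonneg he.le (q - 1)) (overlap_nonneg U V i k))
  have e1 : e k ^ (q - p) = e k ^ (1 - p) * e k ^ (q - 1) := by
    rw [← Real.rpow_add he]; congr 1; ring
  have e2 : e k ^ q = e k * e k ^ (q - 1) := by
    rw [mul_comm, ← Real.rpow_add_one he.ne', sub_add_cancel]
  rw [e1, e2]
  linarith

/-- Equality case of Klein's inequality. -/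
theorem eq_of_klein_eq {A Z : Matrix n n ℂ} (hA : A.PosSemidef) (hZ : Z.PosDef) {p : ℝ}
    (hp : 1 < p) (h0 : (mpow A p * mpow Z (1 - p)).trace.re ≤
      p * A.trace.re + (1 - p) * Z.trace.re) : A = Z := by
  obtain ⟨U, d, h⟩ := exists_isSpectral hA.isHermitian
  obtain ⟨V, e, h'⟩ := exists_isSpectral hZ.isHermitian
  rw [trace_mul_eq_sum_overlap (h.mpow _) (h'.mpow _), h.trace_re, h'.trace_re,
    ← sum_sum_right_mul_overlap h h' e, ← sum_sum_left_mul_overlap h h' d, Complex.ofReal_re] at h0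
  have h1 : ∑ i, ∑ k, (d i ^ p * e k ^ (1 - p) - (p * d i + (1 - p) * e k)) * overlap U V i k
      ≤ 0 := by
    rw [Finset.mul_sum, Finset.mul_sum, ← Finset.sum_add_distrib, ← sub_nonpos,
      ← Finset.sum_sub_distrib] at h0
    refine le_trans (le_of_eq (Finset.sum_congr rfl fun i _ => ?_)) h0
    rw [Finset.mul_sum, Finset.mul_sum, ← Finset.sum_add_distrib, ← Finset.sum_sub_distrib]
    exact Finset.sum_congr rfl fun k _ => by ring
  have hnn : ∀ i k, 0 ≤ (d i ^ p * e k ^ (1 - p) - (p * d i + (1 - p) * e k)) * overlap U V i k :=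
    fun i k => mul_nonneg (sub_nonneg.2 (tangent_le_rpow_mul_rpow hp.le (h.nonneg hA i)
      (h'.pos hZ k))) (overlap_nonneg _ _ _ _)
  have h2 := le_antisymm h1 (Finset.sum_nonneg fun i _ => Finset.sum_nonneg fun k _ => hnn i k)
  -- Every term of the vanishing sum is zero; strictness of the tangent inequality leaves overlap
  -- only between equal eigenvalues.
  have h3 : hsSq (A - Z) = 0 := by
    rw [hsSq_sub_eq_sum_overlap h h']
    refine Finset.sum_eq_zero fun i hi => Finset.sum_eq_zero fun k hk => ?_
    have h4 := (Finset.sum_eq_zero_iff_of_nonneg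
      (fun i _ => Finset.sum_nonneg fun k _ => hnn i k)).1 h2 i hi
    have h5 := (Finset.sum_eq_zero_iff_of_nonneg (fun k _ => hnn i k)).1 h4 k hk
    rcases mul_eq_zero.1 h5 with h6 | h6
    · have : d i = e k := by
        by_contra hne
        linarith [tangent_lt_rpow_mul_rpow hp (h.nonneg hA i) (h'.pos hZ k) hne]
      rw [this, sub_self]; simp
    · rw [h6, mul_zero]
  exact sub_eq_zero.1 (hsSq_eq_zero h3)

/-- Klein's inequality for `X^(1/p)` with `q = 1`. Together with `exists_trace_mul_mpow_le` it says
that `p * Tr X^(1/p)` is the infimum over `Z` of `Tr X Z^(1-p) + (p-1) Tr Z`, a formula in which `Z`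
need not be normalised. -/
theorem klein_mpow_inv {X Z : Matrix n n ℂ} (hX : X.PosSemidef) (hZ : Z.PosDef) {p : ℝ}
    (hp : 1 < p) :
    p * powTr (1 / p) X + (1 - p) * Z.trace.re ≤ (X * mpow Z (1 - p)).trace.re := by
  have h := klein_mpow (mpow_posSemidef hX (1 / p)) hZ hp.le 1
  have e1 : mpow Z (1 - 1) = 1 := by
    obtain ⟨V, e, h'⟩ := exists_isSpectral hZ.isHermitian
    rw [sub_self, (h'.mpow 0).2]
    simp [h'.mul_conjTranspose]
  rw [e1, Matrix.mul_one, mpow_mpow hX, one_div_mul_cancel (by linarith), mpow_one hX,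
    powTr_one hZ.posSemidef] at h
  exact h

/-- The reverse Hölder inequality. -/
theorem powTr_rpow_le {X Z : Matrix n n ℂ} (hX : X.PosSemidef) (hZ : Z.PosDef) {p : ℝ}
    (hp : 1 < p) (hZ1 : Z.trace.re = 1) :
    powTr (1 / p) X ^ p ≤ (X * mpow Z (1 - p)).trace.re := by
  set C := powTr (1 / p) X with hC
  rcases (powTr_nonneg hX (1 / p)).eq_or_lt with h0 | h0
  · rw [hC, ← h0, Real.zero_rpow (by linarith)]
    exact trace_mul_re_nonneg hX (mpow_posSemidef hZ.posSemidef _)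
  -- Rescaling `Z` to trace `C` makes the linear terms combine to `C`; homogeneity then gives the
  -- multiplicative form.
  have hCZ : ((C : ℂ) • Z).PosDef := hZ.smul (by exact_mod_cast h0)
  have h := klein_mpow_inv hX hCZ hp
  rw [mpow_smul hZ.posSemidef h0.le, Matrix.mul_smul, trace_smul, trace_smul, smul_eq_mul,
    smul_eq_mul, Complex.re_ofReal_mul, Complex.re_ofReal_mul, hZ1, ← hC] at h
  have h2 : C ≤ C ^ (1 - p) * (X * mpow Z (1 - p)).trace.re := by linarith
  have h3 := mul_le_mul_of_nonneg_left h2 (Real.rpow_nonneg h0.le (p - 1))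
  rw [← mul_assoc, ← Real.rpow_add h0] at h3
  have e1 : C ^ (p - 1) * C = C ^ p := by
    rw [← Real.rpow_add_one h0.ne', sub_add_cancel]
  rw [e1] at h3
  simpa using h3

theorem mpow_eq_of_trace_le {X Z : Matrix n n ℂ} (hX : X.PosSemidef) (hZ : Z.PosDef) {p : ℝ}
    (hp : 1 < p) (hZ1 : Z.trace.re = 1) (hX1 : powTr (1 / p) X = 1)
    (h : (X * mpow Z (1 - p)).trace.re ≤ 1) : mpow X (1 / p) = Z := by
  refine eq_of_klein_eq (mpow_posSemidef hX _) hZ hp ?_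
  rw [mpow_mpow hX, one_div_mul_cancel (by linarith), mpow_one hX, hZ1]
  rw [powTr] at hX1
  rw [hX1]
  linarith

theorem exists_trace_mul_mpow_le {X : Matrix n n ℂ} (hX : X.PosSemidef) {p : ℝ}
    (hp : 1 < p) {ε : ℝ} (hε : 0 < ε) :
    ∃ Z : Matrix n n ℂ, Z.PosDef ∧
      (X * mpow Z (1 - p)).trace.re + (p - 1) * Z.trace.re ≤ p * powTr (1 / p) X + ε := by
  obtain ⟨U, d, h⟩ := exists_isSpectral hX.isHermitian
  -- The formal optimum `X^(1/p)` may be singular. Shifting its eigenvalues by `δ` costs at most `(p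
  -- - 1) * card n * δ ≤ ε`; the `+ 1` keeps `N` positive when `n` is empty.
  have hp0 : p - 1 > 0 := by linarith
  set N : ℝ := (p - 1) * Fintype.card n + 1 with hN
  have hN0 : 0 < N := by positivity
  set δ := ε / N with hδ
  have hδ0 : 0 < δ := by positivity
  have hZ : IsSpectral (U * diagonal (fun i => ((d i ^ (1 / p) + δ : ℝ) : ℂ)) * Uᴴ) U
    (fun i => d i ^ (1 / p) + δ) := ⟨h.1, rfl⟩
  have hpos : ∀ i, 0 < d i ^ (1 / p) + δ := fun i =>
    add_pos_of_nonneg_of_pos (Real.rpow_nonneg (h.nonneg hX i) _) hδ0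
  refine ⟨_, hZ.posDef hpos, ?_⟩
  have hov : ∀ i k, overlap U U i k = if i = k then 1 else 0 := by
    intro i k
    rw [overlap, h.1, one_apply]
    split_ifs <;> simp
  rw [trace_mul_eq_sum_overlap h (hZ.mpow _), Complex.ofReal_re, hZ.trace_re, h.powTr]
  simp only [hov, mul_ite, mul_one, mul_zero, Finset.sum_ite_eq, Finset.mem_univ, if_true,
    Finset.sum_add_distrib, Finset.sum_const, Finset.card_univ, nsmul_eq_mul]
  have h1 : ∀ i, d i * (d i ^ (1 / p) + δ) ^ (1 - p) ≤ d i ^ (1 / p) := by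
    intro i
    rcases (h.nonneg hX i).eq_or_lt with h0 | h0
    · rw [← h0, zero_mul, Real.zero_rpow (by positivity)]
    · have h2 : (d i ^ (1 / p) + δ) ^ (1 - p) ≤ (d i ^ (1 / p)) ^ (1 - p) :=
        Real.rpow_le_rpow_of_nonpos (Real.rpow_pos_of_pos h0 _) (by linarith) (by linarith)
      refine (mul_le_mul_of_nonneg_left h2 h0.le).trans (le_of_eq ?_)
      rw [← Real.rpow_mul h0.le, ← Real.rpow_one_add' h0.le]
      · congr 1; field_simp; ring
      · have : 1 + 1 / p * (1 - p) = 1 / p := by field_simp; ring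
        rw [this]; positivity
  have h2 := Finset.sum_le_sum fun i (_ : i ∈ Finset.univ) => h1 i
  have h3 : (p - 1) * (Fintype.card n * δ) ≤ ε := by
    have : N * δ = ε := by rw [hδ]; field_simp
    rw [← this, hN]; nlinarith
  linarith

end ReverseHolder

/-! ### Ando's convexity theorem by an integral representation. -/

section Subadditivity

variable {a b n : Type*} [Fintype a] [DecidableEq a] [Fintype b] [Fintype n] [DecidableEq n]

theorem trace_mul_mul_mul_eq_sum {A U : Matrix a a ℂ} {d : a → ℝ} {B V : Matrix n n ℂ} {e : n → ℝ}
    (h : IsSpectral A U d) (h' : IsSpectral B V e) (X Y : Matrix a n ℂ) :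
    (Xᴴ * A * Y * B).trace =
      ∑ i, ∑ k, (d i : ℂ) * (e k : ℂ) * (star ((Uᴴ * X * V) i k) * (Uᴴ * Y * V) i k) := by
  have h1 : (Xᴴ * A * Y * B).trace = ((Uᴴ * X * V)ᴴ * diagonal (fun i => (d i : ℂ)) *
      (Uᴴ * Y * V) * diagonal (fun i => (e i : ℂ))).trace := by
    rw [h.2, h'.2, ← Matrix.mul_assoc, ← Matrix.mul_assoc, trace_mul_comm]
    simp only [conjTranspose_mul, conjTranspose_conjTranspose, Matrix.mul_assoc]
  rw [h1, trace, Finset.sum_comm]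
  refine Finset.sum_congr rfl fun k _ => ?_
  rw [diag_apply, mul_diagonal, Matrix.mul_apply, Finset.sum_mul]
  refine Finset.sum_congr rfl fun i _ => ?_
  rw [mul_diagonal, conjTranspose_apply]
  ring

theorem IsSpectral.one_of {A U : Matrix a a ℂ} {d : a → ℝ} (h : IsSpectral A U d) :
    IsSpectral (1 : Matrix a a ℂ) U (fun _ => 1) := by
  refine ⟨h.1, ?_⟩
  simp [h.mul_conjTranspose]

/-- The affine minorants of the jointly convex form `K ↦ ⟨K, τ² / (s τ + t Z) K⟩`, where `τ` acts
from the left and `Z` from the right. -/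
noncomputable def ratioMinorant (s t : ℝ) (τ : Matrix a a ℂ) (Z : Matrix n n ℂ)
    (K Y : Matrix a n ℂ) : ℝ :=
  2 * (Yᴴ * τ * K).trace.re - s * (Yᴴ * τ * Y).trace.re - t * (Yᴴ * Y * Z).trace.re

/-- At fixed `Y` the minorant is linear in `(τ, Z)`, so the supremum over `Y` is subadditive. -/
theorem ratioMinorant_add (s t : ℝ) (τ τ' : Matrix a a ℂ) (Z Z' : Matrix n n ℂ)
    (K Y : Matrix a n ℂ) : ratioMinorant s t (τ + τ') (Z + Z') K Y =
      ratioMinorant s t τ Z K Y + ratioMinorant s t τ' Z' K Y := by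
  simp only [ratioMinorant, Matrix.mul_add, Matrix.add_mul, trace_add, Complex.add_re]
  ring

/-- The form `⟨K, τ² / (s τ + t Z) K⟩` in terms of spectral decompositions. -/
noncomputable def ratioForm (s t : ℝ) (U : Matrix a a ℂ) (d : a → ℝ) (V : Matrix n n ℂ)
    (e : n → ℝ) (K : Matrix a n ℂ) : ℝ :=
  ∑ i, ∑ k, d i ^ 2 / (s * d i + t * e k) * Complex.normSq ((Uᴴ * K * V) i k)

theorem ratioMinorant_eq_sum {τ U : Matrix a a ℂ} {d : a → ℝ} {Z V : Matrix n n ℂ} {e : n → ℝ}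
    (h : IsSpectral τ U d) (h' : IsSpectral Z V e) (s t : ℝ) (K Y : Matrix a n ℂ) :
    ratioMinorant s t τ Z K Y = ∑ i, ∑ k,
      (2 * d i * (star ((Uᴴ * Y * V) i k) * (Uᴴ * K * V) i k).re -
        (s * d i + t * e k) * Complex.normSq ((Uᴴ * Y * V) i k)) := by
  have h1 := trace_mul_mul_mul_eq_sum h h'.one_of Y K
  have h2 := trace_mul_mul_mul_eq_sum h h'.one_of Y Y
  have h3 := trace_mul_mul_mul_eq_sum h.one_of h' Y Y
  rw [Matrix.mul_one] at h1 h2 h3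
  have hsq : ∀ z : ℂ, (star z * z) = (Complex.normSq z : ℂ) := fun z => by
    rw [Complex.normSq_eq_conj_mul_self]; rfl
  rw [ratioMinorant, h1, h2, h3]
  simp only [hsq, Complex.re_sum, Complex.ofReal_one, mul_one, one_mul, mul_assoc,
    Complex.re_ofReal_mul, Complex.ofReal_re]
  simp only [Finset.mul_sum, ← Finset.sum_sub_distrib]
  refine Finset.sum_congr rfl fun i _ => Finset.sum_congr rfl fun k _ => ?_
  ring

/-- Completing the square: in the eigenbases the gap is a sum of terms `|w y - d z|² / w`. -/
theorem ratioMinorant_le {τ U : Matrix a a ℂ} {d : a → ℝ} {Z V : Matrix n n ℂ} {e : n → ℝ}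
    (h : IsSpectral τ U d) (h' : IsSpectral Z V e) {s t : ℝ}
    (hpos : ∀ i k, 0 < s * d i + t * e k) (K Y : Matrix a n ℂ) :
    ratioMinorant s t τ Z K Y ≤ ratioForm s t U d V e K := by
  rw [ratioMinorant_eq_sum h h', ratioForm]
  refine Finset.sum_le_sum fun i _ => Finset.sum_le_sum fun k _ => ?_
  set w := s * d i + t * e k
  have hw : 0 < w := hpos i k
  set y := (Uᴴ * Y * V) i k
  set z := (Uᴴ * K * V) i k
  have h1 : 0 ≤ Complex.normSq ((w : ℂ) * y - (d i : ℂ) * z) / w :=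
    div_nonneg (Complex.normSq_nonneg _) hw.le
  have h2 : Complex.normSq ((w : ℂ) * y - (d i : ℂ) * z) / w = d i ^ 2 / w * Complex.normSq z -
      (2 * d i * (star y * z).re - w * Complex.normSq y) := by
    simp only [Complex.normSq_apply, Complex.sub_re, Complex.sub_im, RCLike.star_def, Complex.mul_re, Complex.conj_re, Complex.conj_im, Complex.mul_im, Complex.ofReal_re,
      Complex.ofReal_im]
    field_simp
    ring
  linarith

theorem exists_ratioMinorant_eq {τ U : Matrix a a ℂ} {d : a → ℝ} {Z V : Matrix n n ℂ} {e : n → ℝ}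
    (h : IsSpectral τ U d) (h' : IsSpectral Z V e) {s t : ℝ}
    (hpos : ∀ i k, 0 < s * d i + t * e k) (K : Matrix a n ℂ) :
    ∃ Y, ratioForm s t U d V e K = ratioMinorant s t τ Z K Y := by
  -- The zero of the completed square, `y = (d / w) z` entrywise.
  set y : Matrix a n ℂ :=
    Matrix.of fun i k => ((d i / (s * d i + t * e k) : ℝ) : ℂ) * (Uᴴ * K * V) i k with hy
  refine ⟨U * y * Vᴴ, ?_⟩
  have h1 : Uᴴ * (U * y * Vᴴ) * V = y := by
    rw [Matrix.mul_assoc, Matrix.mul_assoc, h'.1, Matrix.mul_one, ← Matrix.mul_assoc, h.1,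
      Matrix.one_mul]
  rw [ratioMinorant_eq_sum h h', ratioForm, h1]
  refine Finset.sum_congr rfl fun i _ => Finset.sum_congr rfl fun k _ => ?_
  rw [hy, Matrix.of_apply]
  have hw : 0 < s * d i + t * e k := hpos i k
  set w := s * d i + t * e k
  set z := (Uᴴ * K * V) i k
  have h2 : star (((d i / w : ℝ) : ℂ) * z) * z = ((d i / w * Complex.normSq z : ℝ) : ℂ) := by
    rw [star_mul', Complex.ofReal_mul, Complex.normSq_eq_conj_mul_self, RCLike.star_def,
      Complex.conj_ofReal]
    ring
  rw [h2, Complex.ofReal_re, map_mul, Complex.normSq_ofReal]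
  field_simp
  ring

/-- Joint subadditivity (equivalently, joint convexity) of `⟨K, τ² / (s τ + t Z) K⟩`. -/
theorem ratioForm_add_le {τ τ' U U' W : Matrix a a ℂ} {d d' f : a → ℝ}
    {Z Z' V V' R : Matrix n n ℂ} {e e' g : n → ℝ}
    (h : IsSpectral τ U d) (h' : IsSpectral τ' U' d') (hs : IsSpectral (τ + τ') W f)
    (hz : IsSpectral Z V e) (hz' : IsSpectral Z' V' e') (hzs : IsSpectral (Z + Z') R g)
    {s t : ℝ} (hp : ∀ i k, 0 < s * d i + t * e k) (hp' : ∀ i k, 0 < s * d' i + t * e' k)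
    (hps : ∀ i k, 0 < s * f i + t * g k) (K : Matrix a n ℂ) :
    ratioForm s t W f R g K ≤ ratioForm s t U d V e K + ratioForm s t U' d' V' e' K := by
  obtain ⟨Y, hY⟩ := exists_ratioMinorant_eq hs hzs hps K
  rw [hY, ratioMinorant_add]
  exact add_le_add (ratioMinorant_le h hz hp K Y) (ratioMinorant_le h' hz' hp' K Y)

/-- The value `Tr Kᴴ τ^p K Z^(1-p)`, which is jointly convex for `1 ≤ p ≤ 2`. -/
noncomputable def andoForm (p : ℝ) (τ : Matrix a a ℂ) (Z : Matrix n n ℂ) (K : Matrix a n ℂ) : ℝ :=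
  (Kᴴ * mpow τ p * K * mpow Z (1 - p)).trace.re

theorem andoForm_eq_sum {τ U : Matrix a a ℂ} {d : a → ℝ} {Z V : Matrix n n ℂ} {e : n → ℝ}
    (h : IsSpectral τ U d) (h' : IsSpectral Z V e) (p : ℝ) (K : Matrix a n ℂ) :
    andoForm p τ Z K =
      ∑ i, ∑ k, d i ^ p * e k ^ (1 - p) * Complex.normSq ((Uᴴ * K * V) i k) := by
  rw [andoForm, trace_mul_funcCalc_mul (h.mpow p) (h'.mpow _), Complex.ofReal_re]

-- The integral representation of `u^(p-1)` at `u = x / y`, multiplied by `x`. It writes the Ando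
-- kernel as a positive superposition of the kernels of `ratioForm`.
open MeasureTheory in
theorem exists_measure_rpow_mul_rpow {p : ℝ} (hp : p ∈ Set.Ioo (1 : ℝ) 2) :
    ∃ (μ : Measure ℝ) (w : ℝ → ℝ), (∀ t, 0 < t → 0 ≤ w t) ∧ ∀ x y : ℝ, 0 ≤ x → 0 < y →
      IntegrableOn (fun t => w t * (x ^ 2 / (1 * x + t * y))) (Set.Ioi 0) μ ∧
      x ^ p * y ^ (1 - p) = ∫ t in Set.Ioi 0, w t * (x ^ 2 / (1 * x + t * y)) ∂μ := by
  have hq : p - 1 ∈ Set.Ioo (0 : ℝ) 1 := ⟨by linarith [hp.1], by linarith [hp.2]⟩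
  obtain ⟨μ, hμ⟩ := Real.exists_measure_rpow_eq_integral_rpowIntegrand₀₁ hq
  refine ⟨μ, fun t => t ^ (p - 1 - 1), fun t ht => Real.rpow_nonneg ht.le _,
    fun x y hx hy => ?_⟩
  obtain ⟨h1, h2⟩ := hμ (x / y) (div_nonneg hx hy.le)
  have heq : Set.EqOn (fun t => x * Real.rpowIntegrand₀₁ (p - 1) t (x / y))
      (fun t => t ^ (p - 1 - 1) * (x ^ 2 / (1 * x + t * y))) (Set.Ioi 0) := by
    intro t ht
    have ht' : 0 < t := ht
    simp only
    rw [Real.rpowIntegrand₀₁_eq_pow_div hq ht'.le (div_nonneg hx hy.le)]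
    have : 0 < t + x / y := by positivity
    have : 0 < 1 * x + t * y := by positivity
    field_simp
    ring
  refine ⟨IntegrableOn.congr_fun (h1.const_mul x) heq measurableSet_Ioi, ?_⟩
  rw [← setIntegral_congr_fun measurableSet_Ioi heq, integral_const_mul, ← h2,
    Real.div_rpow hx hy.le, ← mul_div_assoc, ← Real.rpow_one_add' hx (by linarith [hp.1])]
  rw [show 1 + (p - 1) = p by ring, show 1 - p = -(p - 1) by ring, Real.rpow_neg hy.le]
  rfl

/-- **Ando's convexity theorem** (in its homogeneous form). -/
theorem andoForm_add_le {p : ℝ} (hp : 1 < p) (hp2 : p ≤ 2) {τ τ' : Matrix a a ℂ}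
    {Z Z' : Matrix n n ℂ} (hτ : τ.PosSemidef) (hτ' : τ'.PosSemidef) (hZ : Z.PosDef)
    (hZ' : Z'.PosDef) (K : Matrix a n ℂ) :
    andoForm p (τ + τ') (Z + Z') K ≤ andoForm p τ Z K + andoForm p τ' Z' K := by
  obtain ⟨U, d, h⟩ := exists_isSpectral hτ.isHermitian
  obtain ⟨U', d', h'⟩ := exists_isSpectral hτ'.isHermitian
  obtain ⟨W, f, hs⟩ := exists_isSpectral (hτ.add hτ').isHermitian
  obtain ⟨V, e, hz⟩ := exists_isSpectral hZ.isHermitian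
  obtain ⟨V', e', hz'⟩ := exists_isSpectral hZ'.isHermitian
  obtain ⟨R, g, hzs⟩ := exists_isSpectral (hZ.add hZ').isHermitian
  have d0 := h.nonneg hτ
  have d0' := h'.nonneg hτ'
  have f0 := hs.nonneg (hτ.add hτ')
  have e0 := hz.pos hZ
  have e0' := hz'.pos hZ'
  have g0 := hzs.pos (hZ.add hZ')
  rw [andoForm_eq_sum h hz, andoForm_eq_sum h' hz', andoForm_eq_sum hs hzs]
  rcases hp2.eq_or_lt with rfl | hp2
  -- At the endpoint `p = 2` the integral representation is unavailable, but the kernel `x² / y` is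
  -- itself the case `s = 0`, `t = 1`.
  · have key := ratioForm_add_le h h' hs hz hz' hzs (s := 0) (t := 1)
      (fun i k => by linarith [e0 k]) (fun i k => by linarith [e0' k])
      (fun i k => by linarith [g0 k]) K
    have e1 : ∀ (U : Matrix a a ℂ) (d : a → ℝ) (V : Matrix n n ℂ) (e : n → ℝ),
        ratioForm 0 1 U d V e K = ∑ i, ∑ k, d i ^ (2 : ℝ) * e k ^ (1 - 2 : ℝ) *
          Complex.normSq ((Uᴴ * K * V) i k) := by
      intro U d V e
      refine Finset.sum_congr rfl fun i _ => Finset.sum_congr rfl fun k _ => ?_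
      norm_num [Real.rpow_neg_one, div_eq_mul_inv]
    rw [e1, e1, e1] at key
    exact key
  · obtain ⟨μ, w, hw, hμ⟩ := exists_measure_rpow_mul_rpow ⟨hp, hp2⟩
    have key : ∀ (U : Matrix a a ℂ) (d : a → ℝ) (V : Matrix n n ℂ) (e : n → ℝ),
        (∀ i, 0 ≤ d i) → (∀ i, 0 < e i) →
        MeasureTheory.IntegrableOn (fun t => w t * ratioForm 1 t U d V e K) (Set.Ioi 0) μ ∧
        ∑ i, ∑ k, d i ^ p * e k ^ (1 - p) * Complex.normSq ((Uᴴ * K * V) i k) =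
          ∫ t in Set.Ioi 0, w t * ratioForm 1 t U d V e K ∂μ := by
      intro U d V e hd he
      have e1 : (fun t => w t * ratioForm 1 t U d V e K) = fun t => ∑ i, ∑ k,
          (w t * (d i ^ 2 / (1 * d i + t * e k))) * Complex.normSq ((Uᴴ * K * V) i k) := by
        ext t
        simp only [ratioForm, Finset.mul_sum, mul_assoc]
      have hint : ∀ i k, MeasureTheory.IntegrableOn (fun t =>
          (w t * (d i ^ 2 / (1 * d i + t * e k))) * Complex.normSq ((Uᴴ * K * V) i k))
          (Set.Ioi 0) μ := fun i k => (hμ (d i) (e k) (hd i) (he k)).1.mul_const _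
      rw [e1]
      refine ⟨MeasureTheory.integrable_finsetSum _ fun i _ =>
        MeasureTheory.integrable_finsetSum _ fun k _ => hint i k, ?_⟩
      rw [MeasureTheory.integral_finsetSum _ fun i _ =>
        MeasureTheory.integrable_finsetSum _ fun k _ => hint i k]
      refine Finset.sum_congr rfl fun i _ => ?_
      rw [MeasureTheory.integral_finsetSum _ fun k _ => hint i k]
      refine Finset.sum_congr rfl fun k _ => ?_
      rw [MeasureTheory.integral_mul_const, ← (hμ (d i) (e k) (hd i) (he k)).2]
    obtain ⟨i1, k1⟩ := key U d V e d0 e0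
    obtain ⟨i2, k2⟩ := key U' d' V' e' d0' e0'
    obtain ⟨i3, k3⟩ := key W f R g f0 g0
    rw [k1, k2, k3, ← MeasureTheory.integral_add i1 i2]
    refine MeasureTheory.setIntegral_mono_on i3 (i1.add i2) measurableSet_Ioi fun t ht => ?_
    have ht' : (0 : ℝ) < t := ht
    rw [← mul_add]
    refine mul_le_mul_of_nonneg_left (ratioForm_add_le h h' hs hz hz' hzs
      (fun i k => ?_) (fun i k => ?_) (fun i k => ?_) K) (hw t ht')
    · have := mul_pos ht' (e0 k); linarith [d0 i]
    · have := mul_pos ht' (e0' k); linarith [d0' i]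
    · have := mul_pos ht' (g0 k); linarith [f0 i]

end Subadditivity

/-! ### Tangent inequality at a critical point, without differentiating matrix powers. -/

section Tangent

variable {a b n : Type*} [Fintype a] [DecidableEq a] [Fintype b] [Fintype n] [DecidableEq n]

/-- The completely positive map with Kraus operators `(K y)ᴴ`. -/
noncomputable def krausMap (K : b → Matrix a n ℂ) (S : Matrix a a ℂ) : Matrix n n ℂ :=
  ∑ y, (K y)ᴴ * S * K y

/-- The adjoint of `krausMap K` for the trace pairing. -/
noncomputable def krausAdjoint (K : b → Matrix a n ℂ) (W : Matrix n n ℂ) : Matrix a a ℂ :=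
  ∑ y, K y * W * (K y)ᴴ

theorem trace_krausMap_mul (K : b → Matrix a n ℂ) (S : Matrix a a ℂ) (W : Matrix n n ℂ) :
    (krausMap K S * W).trace = (S * krausAdjoint K W).trace := by
  rw [krausMap, krausAdjoint, Finset.sum_mul, Finset.mul_sum, trace_sum, trace_sum]
  refine Finset.sum_congr rfl fun y _ => ?_
  rw [Matrix.mul_assoc, Matrix.mul_assoc, trace_mul_comm]
  simp only [Matrix.mul_assoc]

theorem krausMap_smul (K : b → Matrix a n ℂ) (c : ℂ) (S : Matrix a a ℂ) :
    krausMap K (c • S) = c • krausMap K S := by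
  simp only [krausMap, Matrix.mul_smul, Matrix.smul_mul, Finset.smul_sum]

theorem krausMap_posSemidef (K : b → Matrix a n ℂ) {S : Matrix a a ℂ} (hS : S.PosSemidef) :
    (krausMap K S).PosSemidef :=
  posSemidef_sum _ fun y _ => hS.conjTranspose_mul_mul_same (K y)

theorem krausAdjoint_posSemidef (K : b → Matrix a n ℂ) {W : Matrix n n ℂ} (hW : W.PosSemidef) :
    (krausAdjoint K W).PosSemidef :=
  posSemidef_sum _ fun y _ => hW.mul_mul_conjTranspose_same (K y)

theorem trace_krausMap_mpow_mul (p : ℝ) (τ : Matrix a a ℂ) (Z : Matrix n n ℂ)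
    (K : b → Matrix a n ℂ) :
    (krausMap K (mpow τ p) * mpow Z (1 - p)).trace.re = ∑ y, andoForm p τ Z (K y) := by
  rw [krausMap, Finset.sum_mul, trace_sum, Complex.re_sum]
  rfl

theorem trace_krausMap_mpow_add_le {p : ℝ} (hp : 1 < p) (hp2 : p ≤ 2) {τ τ' : Matrix a a ℂ}
    {Z Z' : Matrix n n ℂ} (hτ : τ.PosSemidef) (hτ' : τ'.PosSemidef) (hZ : Z.PosDef)
    (hZ' : Z'.PosDef) (K : b → Matrix a n ℂ) :
    (krausMap K (mpow (τ + τ') p) * mpow (Z + Z') (1 - p)).trace.re ≤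
      (krausMap K (mpow τ p) * mpow Z (1 - p)).trace.re +
        (krausMap K (mpow τ' p) * mpow Z' (1 - p)).trace.re := by
  rw [trace_krausMap_mpow_mul, trace_krausMap_mpow_mul, trace_krausMap_mpow_mul,
    ← Finset.sum_add_distrib]
  exact Finset.sum_le_sum fun y _ => andoForm_add_le hp hp2 hτ hτ' hZ hZ' (K y)

theorem trace_krausMap_mpow_smul {p : ℝ} {τ : Matrix a a ℂ} {Z : Matrix n n ℂ}
    (hτ : τ.PosSemidef) (hZ : Z.PosSemidef) (K : b → Matrix a n ℂ) {t : ℝ} (ht : 0 < t) :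
    (krausMap K (mpow ((t : ℂ) • τ) p) * mpow ((t : ℂ) • Z) (1 - p)).trace.re =
      t * (krausMap K (mpow τ p) * mpow Z (1 - p)).trace.re := by
  rw [mpow_smul hτ ht.le, mpow_smul hZ ht.le, krausMap_smul, Matrix.mul_smul, Matrix.smul_mul,
    smul_smul, ← Complex.ofReal_mul, ← Real.rpow_add ht, trace_smul, smul_eq_mul,
    Complex.re_ofReal_mul]
  congr 1
  rw [sub_add_cancel, Real.rpow_one]

theorem exists_lipschitz_rpow (s : ℝ) {m M : ℝ} (hm : 0 < m) :
    ∃ L : ℝ, 0 ≤ L ∧ ∀ x ∈ Set.Icc m M, ∀ y ∈ Set.Icc m M, |x ^ s - y ^ s| ≤ L * |x - y| := by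
  have hc : ContinuousOn (fun x : ℝ => s * x ^ (s - 1)) (Set.Icc m M) := by
    refine continuousOn_const.mul (continuousOn_id.rpow_const fun x hx => Or.inl ?_)
    exact (lt_of_lt_of_le hm hx.1).ne'
  obtain ⟨L, hL⟩ := isCompact_Icc.exists_bound_of_continuousOn hc
  refine ⟨max L 0, le_max_right _ _, fun x hx y hy => ?_⟩
  have h := (convex_Icc m M).norm_image_sub_le_of_norm_hasDerivWithin_le
    (f := fun x : ℝ => x ^ s) (f' := fun x : ℝ => s * x ^ (s - 1)) (C := max L 0)
    (fun x hx => (Real.hasDerivAt_rpow_const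
      (Or.inl (lt_of_lt_of_le hm hx.1).ne')).hasDerivWithinAt)
    (fun x hx => (hL x hx).trans (le_max_left _ _)) hy hx
  exact h

theorem IsSpectral.sub_smul_one {A U : Matrix n n ℂ} {d : n → ℝ} (h : IsSpectral A U d) (c : ℝ) :
    IsSpectral (A - (c : ℂ) • 1) U (fun i => d i - c) := by
  refine ⟨h.1, ?_⟩
  have : diagonal (fun i => ((d i - c : ℝ) : ℂ)) = diagonal (fun i => (d i : ℂ)) - (c : ℂ) • 1 := by
    ext i j
    by_cases hij : i = j <;> simp [hij, one_apply]
  rw [this, Matrix.mul_sub, Matrix.sub_mul, ← h.2, Matrix.mul_smul, Matrix.mul_one,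
    Matrix.smul_mul, h.mul_conjTranspose]

theorem exists_pos_forall_le {d : n → ℝ} (hd : ∀ i, 0 < d i) : ∃ m : ℝ, 0 < m ∧ ∀ i, m ≤ d i := by
  rcases isEmpty_or_nonempty n with hn | hn
  · exact ⟨1, one_pos, fun i => hn.elim i⟩
  · obtain ⟨i, hi⟩ := Finite.exists_min d
    exact ⟨d i, hd i, hi⟩

/-- For `0 < t ≤ 1` the spectra of `A` and `A + t B` stay in one interval `[m, M]` with `m > 0`,
where `x^s` is Lipschitz; the overlap formula lifts this to the Hilbert–Schmidt norm. It makes the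
cross term of the tangent argument second order in `t`. -/
theorem exists_hsSq_mpow_add_sub_le {A B : Matrix n n ℂ} (hA : A.PosDef) (hB : B.PosDef) (s : ℝ) :
    ∃ L : ℝ, 0 ≤ L ∧ ∀ t : ℝ, 0 < t → t ≤ 1 →
      √(hsSq (mpow (A + (t : ℂ) • B) s - mpow A s)) ≤ L * t := by
  obtain ⟨V, e, h'⟩ := exists_isSpectral hA.isHermitian
  obtain ⟨m, hm, hme⟩ := exists_pos_forall_le (h'.pos hA)
  set M := A.trace.re + B.trace.re with hM
  obtain ⟨L, hL0, hL⟩ := exists_lipschitz_rpow s (m := m) (M := M) hm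
  refine ⟨L * √(hsSq B), by positivity, fun t ht ht1 => ?_⟩
  have htB : ((t : ℂ) • B).PosDef := hB.smul (by exact_mod_cast ht)
  obtain ⟨U, d, h⟩ := exists_isSpectral (hA.add htB).isHermitian
  have hBtr : 0 ≤ B.trace.re := by
    obtain ⟨W, f, hf⟩ := exists_isSpectral hB.isHermitian
    rw [hf.trace_re]
    exact Finset.sum_nonneg fun i _ => (hf.pos hB i).le
  have hdl : ∀ i, d i ∈ Set.Icc m M := by
    intro i
    constructor
    · have h1 : (A + (t : ℂ) • B - (m : ℂ) • 1).PosSemidef := by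
        have h2 : (A - (m : ℂ) • 1).PosSemidef :=
          (h'.sub_smul_one m).posSemidef fun i => sub_nonneg.2 (hme i)
        have := h2.add htB.posSemidef
        convert this using 1
        abel
      exact sub_nonneg.1 ((h.sub_smul_one m).nonneg h1 i)
    · have h1 : d i ≤ ∑ j, d j :=
        Finset.single_le_sum (fun j _ => (h.pos (hA.add htB) j).le) (Finset.mem_univ i)
      rw [← h.trace_re, trace_add, trace_smul, smul_eq_mul, Complex.add_re,
        Complex.re_ofReal_mul] at h1
      nlinarith
  have hel : ∀ i, e i ∈ Set.Icc m M := by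
    intro i
    refine ⟨hme i, ?_⟩
    have h1 : e i ≤ ∑ j, e j :=
      Finset.single_le_sum (fun j _ => (h'.pos hA j).le) (Finset.mem_univ i)
    rw [← h'.trace_re] at h1
    linarith
  have h1 : hsSq (mpow (A + (t : ℂ) • B) s - mpow A s) ≤ L ^ 2 * hsSq ((t : ℂ) • B) := by
    have e1 : hsSq ((t : ℂ) • B) = hsSq (A + (t : ℂ) • B - A) := by rw [add_sub_cancel_left]
    rw [e1, hsSq_sub_eq_sum_overlap h h', hsSq_sub_eq_sum_overlap (h.mpow s) (h'.mpow s),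
      Finset.mul_sum]
    refine Finset.sum_le_sum fun i _ => ?_
    rw [Finset.mul_sum]
    refine Finset.sum_le_sum fun k _ => ?_
    rw [← mul_assoc]
    refine mul_le_mul_of_nonneg_right ?_ (overlap_nonneg _ _ _ _)
    rw [← mul_pow]
    refine sq_le_sq.2 ?_
    rw [abs_mul, abs_of_nonneg hL0]
    exact hL _ (hdl i) _ (hel k)
  have h2 : hsSq ((t : ℂ) • B) = t ^ 2 * hsSq B := by
    simp only [hsSq, Matrix.smul_apply, smul_eq_mul, map_mul, Complex.normSq_ofReal, Finset.mul_sum]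
    exact Finset.sum_congr rfl fun i _ => Finset.sum_congr rfl fun j _ => by ring
  refine (Real.sqrt_le_sqrt h1).trans (le_of_eq ?_)
  rw [h2, ← mul_assoc, ← mul_pow, Real.sqrt_mul (sq_nonneg _), Real.sqrt_sq (by positivity)]
  ring

theorem exists_trace_krausMap_mul_le (K : b → Matrix a n ℂ) :
    ∃ C : ℝ, 0 ≤ C ∧ ∀ (D : Matrix a a ℂ) (E : Matrix n n ℂ),
      |(krausMap K D * E).trace.re| ≤ C * √(hsSq D) * √(hsSq E) := by
  refine ⟨∑ y, ∑ i, ∑ j, ∑ l, ∑ k, ‖K y k i‖ * ‖K y l j‖, by positivity, fun D E => ?_⟩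
  refine (Complex.abs_re_le_norm _).trans ?_
  have h1 : (krausMap K D * E).trace =
      ∑ y, ∑ i, ∑ j, ∑ l, ∑ k, star (K y k i) * D k l * K y l j * E j i := by
    rw [krausMap, Finset.sum_mul, trace_sum]
    refine Finset.sum_congr rfl fun y _ => ?_
    simp only [trace, diag_apply, Matrix.mul_apply, conjTranspose_apply, Finset.sum_mul]
  rw [h1]
  simp only [Finset.sum_mul]
  refine norm_sum_le_of_le _ fun y _ => norm_sum_le_of_le _ fun i _ => norm_sum_le_of_le _
    fun j _ => norm_sum_le_of_le _ fun l _ => norm_sum_le_of_le _ fun k _ => ?_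
  rw [norm_mul, norm_mul, norm_mul, norm_star]
  have hD := norm_apply_le_sqrt_hsSq D k l
  have hE := norm_apply_le_sqrt_hsSq E j i
  calc ‖K y k i‖ * ‖D k l‖ * ‖K y l j‖ * ‖E j i‖
      ≤ ‖K y k i‖ * √(hsSq D) * ‖K y l j‖ * √(hsSq E) := by gcongr
    _ = _ := by ring

theorem krausMap_sub (K : b → Matrix a n ℂ) (S T : Matrix a a ℂ) :
    krausMap K (S - T) = krausMap K S - krausMap K T := by
  simp only [krausMap, Matrix.mul_sub, Matrix.sub_mul, Finset.sum_sub_distrib]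

/-- At a positive definite critical point, the jointly convex functional
`(τ, Z) ↦ Tr Φ(τ^p) Z^(1-p)` lies above its tangent. -/
theorem tangent_le_trace_krausMap {p r c : ℝ} (hp : 1 < p) (hp2 : p ≤ 2) (hc : 0 ≤ c)
    (K : b → Matrix a n ℂ) {τ₀ τ : Matrix a a ℂ} {Z₀ Z : Matrix n n ℂ} (hτ₀ : τ₀.PosDef)
    (hτ : τ.PosDef) (hZ₀ : Z₀.PosDef) (hZ : Z.PosDef)
    (h₁ : krausMap K (mpow τ₀ p) = (c : ℂ) • mpow Z₀ p)
    (h₂ : krausAdjoint K (mpow Z₀ (1 - p)) = (c : ℂ) • mpow τ₀ (r - p)) :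
    c * (p * (τ * mpow τ₀ (r - 1)).trace.re + (1 - p) * Z.trace.re) ≤
      (krausMap K (mpow τ p) * mpow Z (1 - p)).trace.re := by
  obtain ⟨C, hC0, hC⟩ := exists_trace_krausMap_mul_le K
  obtain ⟨L₁, hL₁, hD⟩ := exists_hsSq_mpow_add_sub_le hτ₀ hτ p
  obtain ⟨L₂, hL₂, hE⟩ := exists_hsSq_mpow_add_sub_le hZ₀ hZ (1 - p)
  set Q := (krausMap K (mpow τ p) * mpow Z (1 - p)).trace.re with hQ
  set T := (τ * mpow τ₀ (r - 1)).trace.re with hT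
  -- Subadditivity and homogeneity give `F(τ₀ + tτ, Z₀ + tZ) ≤ F(τ₀, Z₀) + t F(τ, Z)`. Up to a cross
  -- term of order `t²`, the left side is `F(τt, Z₀) + F(τ₀, Zt) - F(τ₀, Z₀)`, and the critical
  -- equations turn the one-variable terms into expressions that Klein's inequality bounds below by
  -- their first-order parts.
  have key : ∀ t : ℝ, 0 < t → t ≤ 1 →
      c * (p * T + (1 - p) * Z.trace.re) ≤ Q + C * L₁ * L₂ * t := by
    intro t ht ht1
    have htτ : ((t : ℂ) • τ).PosDef := hτ.smul (by exact_mod_cast ht)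
    have htZ : ((t : ℂ) • Z).PosDef := hZ.smul (by exact_mod_cast ht)
    set τt := τ₀ + (t : ℂ) • τ with hτt
    set Zt := Z₀ + (t : ℂ) • Z with hZt
    have hτtp : τt.PosDef := hτ₀.add htτ
    have hZtp : Zt.PosDef := hZ₀.add htZ
    have hup := trace_krausMap_mpow_add_le hp hp2 hτ₀.posSemidef htτ.posSemidef hZ₀ htZ K
    rw [trace_krausMap_mpow_smul hτ.posSemidef hZ.posSemidef K ht, ← hQ, ← hτt, ← hZt] at hup
    have hcross := (abs_le.1 (hC (mpow τt p - mpow τ₀ p) (mpow Zt (1 - p) - mpow Z₀ (1 - p)))).1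
    have hcb : C * √(hsSq (mpow τt p - mpow τ₀ p)) * √(hsSq (mpow Zt (1 - p) - mpow Z₀ (1 - p)))
        ≤ C * (L₁ * t) * (L₂ * t) := by
      have := hD t ht ht1
      have := hE t ht ht1
      gcongr
    rw [krausMap_sub, Matrix.sub_mul, Matrix.mul_sub, Matrix.mul_sub, trace_sub, trace_sub,
      trace_sub, Complex.sub_re, Complex.sub_re, Complex.sub_re] at hcross
    have hq0 : (krausMap K (mpow τ₀ p) * mpow Z₀ (1 - p)).trace.re = c * Z₀.trace.re := by
      rw [h₁, Matrix.smul_mul, trace_smul, smul_eq_mul, Complex.re_ofReal_mul,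
        mpow_mul_mpow hZ₀, add_sub_cancel, mpow_one hZ₀.posSemidef]
    have hq0' : (krausMap K (mpow τ₀ p) * mpow Z₀ (1 - p)).trace.re = c * powTr r τ₀ := by
      rw [trace_krausMap_mul, h₂, Matrix.mul_smul, trace_smul, smul_eq_mul, Complex.re_ofReal_mul,
        mpow_mul_mpow hτ₀, add_sub_cancel, powTr]
    have hq1 : c * (powTr r τ₀ + t * (p * T)) ≤
        (krausMap K (mpow τt p) * mpow Z₀ (1 - p)).trace.re := by
      rw [trace_krausMap_mul, h₂, Matrix.mul_smul, trace_smul, smul_eq_mul, Complex.re_ofReal_mul]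
      refine mul_le_mul_of_nonneg_left ?_ hc
      refine le_trans (le_of_eq ?_) (klein_mpow hτtp.posSemidef hτ₀ hp.le r)
      have e1 : τ₀ * mpow τ₀ (r - 1) = mpow τ₀ r := by
        nth_rewrite 1 [← mpow_one hτ₀.posSemidef]
        rw [mpow_mul_mpow hτ₀, add_sub_cancel]
      rw [hτt, Matrix.add_mul, e1, trace_add, Complex.add_re, Matrix.smul_mul, trace_smul,
        smul_eq_mul, Complex.re_ofReal_mul, ← hT, powTr]
      ring
    have hq2 : c * (Z₀.trace.re + t * ((1 - p) * Z.trace.re)) ≤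
        (krausMap K (mpow τ₀ p) * mpow Zt (1 - p)).trace.re := by
      rw [h₁, Matrix.smul_mul, trace_smul, smul_eq_mul, Complex.re_ofReal_mul]
      refine mul_le_mul_of_nonneg_left ?_ hc
      have := klein_mpow_inv (mpow_posSemidef hZ₀.posSemidef p) hZtp hp
      refine le_trans (le_of_eq ?_) this
      rw [powTr_mpow hZ₀.posSemidef, mul_one_div_cancel (by linarith), powTr_one hZ₀.posSemidef,
        hZt, trace_add, trace_smul, Complex.add_re, smul_eq_mul, Complex.re_ofReal_mul]
      ring
    have hfin : t * (c * (p * T + (1 - p) * Z.trace.re)) ≤ t * (Q + C * L₁ * L₂ * t) := by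
      nlinarith
    exact le_of_mul_le_mul_left hfin ht
  by_contra hlt
  rw [not_le] at hlt
  set δ := c * (p * T + (1 - p) * Z.trace.re) - Q with hδ
  have hδ0 : 0 < δ := by linarith
  set N := C * L₁ * L₂ with hN
  have hN0 : 0 ≤ N := by positivity
  -- So small that the error `N * t` cannot absorb the assumed gap `δ`.
  set t := min 1 (δ / (2 * (N + 1))) with ht
  have ht0 : 0 < t := lt_min one_pos (by positivity)
  have h3 := key t ht0 (min_le_left _ _)
  have h4 : t ≤ δ / (2 * (N + 1)) := min_le_right _ _
  rw [le_div_iff₀ (by positivity)] at h4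
  nlinarith

end Tangent

/-! ### Continuity of trace powers, existence of minimisers, comparison of exponents. -/

section Compactness

variable {a b n : Type*} [Fintype a] [DecidableEq a] [Fintype b] [Fintype n] [DecidableEq n]

theorem abs_rpow_sub_rpow_le {s x y : ℝ} (hs : 0 ≤ s) (hs1 : s ≤ 1) (hx : 0 ≤ x) (hy : 0 ≤ y) :
    |x ^ s - y ^ s| ≤ |x - y| ^ s := by
  have key : ∀ u v : ℝ, 0 ≤ u → u ≤ v → |v ^ s - u ^ s| ≤ |v - u| ^ s := by
    intro u v hu huv
    have h1 : u ^ s ≤ v ^ s := Real.rpow_le_rpow hu huv hs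
    have h2 := Real.rpow_add_le_add_rpow hu (sub_nonneg.2 huv) hs hs1
    rw [add_sub_cancel] at h2
    rw [abs_of_nonneg (sub_nonneg.2 h1), abs_of_nonneg (sub_nonneg.2 huv)]
    linarith
  rcases le_total x y with h | h
  · rw [abs_sub_comm, abs_sub_comm x y]
    exact key x y hx h
  · exact key y x hy h

/-- Splitting at `u = δ` trades `u^s` for a constant and a square; squared eigenvalue differences
are what `hsSq_sub_eq_sum_overlap` controls. -/
theorem rpow_le_add_sq {s u δ : ℝ} (hs : 0 < s) (hs1 : s ≤ 1) (hu : 0 ≤ u) (hδ : 0 < δ) :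
    u ^ s ≤ δ ^ s + δ ^ (s - 2) * u ^ 2 := by
  rcases le_total u δ with h | h
  · have h1 := Real.rpow_le_rpow hu h hs.le
    have h2 : 0 ≤ δ ^ (s - 2) * u ^ 2 := by positivity
    linarith
  · have hu0 : 0 < u := lt_of_lt_of_le hδ h
    have h1 : u ^ s = u ^ (s - 2) * u ^ 2 := by
      rw [← Real.rpow_natCast u 2, ← Real.rpow_add hu0]
      norm_num
    have h2 : u ^ (s - 2) ≤ δ ^ (s - 2) := Real.rpow_le_rpow_of_nonpos hδ h (by linarith)
    have h3 : 0 ≤ δ ^ s := by positivity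
    rw [h1]
    nlinarith [mul_le_mul_of_nonneg_right h2 (sq_nonneg u)]

theorem abs_powTr_sub_powTr_le {A B : Matrix n n ℂ} (hA : A.PosSemidef) (hB : B.PosSemidef)
    {s δ : ℝ} (hs : 0 < s) (hs1 : s ≤ 1) (hδ : 0 < δ) :
    |powTr s A - powTr s B| ≤ Fintype.card n * δ ^ s + δ ^ (s - 2) * hsSq (A - B) := by
  obtain ⟨U, d, h⟩ := exists_isSpectral hA.isHermitian
  obtain ⟨V, e, h'⟩ := exists_isSpectral hB.isHermitian
  have hc : (Fintype.card n : ℝ) * δ ^ s = ∑ i, ∑ k, δ ^ s * overlap U V i k := by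
    rw [sum_sum_left_mul_overlap h h' (fun _ => δ ^ s)]
    simp
  rw [h.powTr, h'.powTr, ← sum_sum_left_mul_overlap h h' (fun i => d i ^ s),
    ← sum_sum_right_mul_overlap h h' (fun i => e i ^ s), hsSq_sub_eq_sum_overlap h h', hc,
    ← Finset.sum_sub_distrib, Finset.mul_sum, ← Finset.sum_add_distrib]
  refine Finset.abs_sum_le_sum_abs _ _ |>.trans (Finset.sum_le_sum fun i _ => ?_)
  rw [← Finset.sum_sub_distrib, Finset.mul_sum, ← Finset.sum_add_distrib]
  refine Finset.abs_sum_le_sum_abs _ _ |>.trans (Finset.sum_le_sum fun k _ => ?_)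
  rw [← sub_mul, abs_mul, abs_of_nonneg (overlap_nonneg U V i k), ← mul_assoc, ← add_mul]
  refine mul_le_mul_of_nonneg_right ?_ (overlap_nonneg U V i k)
  refine (abs_rpow_sub_rpow_le hs.le hs1 (h.nonneg hA i) (h'.nonneg hB k)).trans ?_
  refine (rpow_le_add_sq hs hs1 (abs_nonneg _) hδ).trans (le_of_eq ?_)
  rw [sq_abs]

theorem continuousOn_powTr {s : ℝ} (hs : 0 < s) (hs1 : s ≤ 1) :
    ContinuousOn (powTr s : Matrix n n ℂ → ℝ) {A | A.PosSemidef} := by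
  intro B hB
  rw [ContinuousWithinAt, Metric.tendsto_nhds]
  intro ε hε
  set N : ℝ := (Fintype.card n : ℝ) with hN
  have hN0 : 0 ≤ N := by positivity
  set δ : ℝ := (ε / (2 * (N + 1))) ^ (1 / s) with hδ
  have hδ0 : 0 < δ := by positivity
  have hδs : δ ^ s = ε / (2 * (N + 1)) := by
    rw [hδ, ← Real.rpow_mul (by positivity), one_div_mul_cancel hs.ne', Real.rpow_one]
  have hcont : Continuous fun A : Matrix n n ℂ => δ ^ (s - 2) * hsSq (A - B) := by
    refine continuous_const.mul ?_
    unfold hsSq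
    refine continuous_finsetSum _ fun i _ => continuous_finsetSum _ fun j _ =>
      Complex.continuous_normSq.comp ?_
    exact (continuous_id.sub continuous_const).matrix_elem i j
  have h0 : δ ^ (s - 2) * hsSq (B - B) < ε / 2 := by
    have : hsSq (B - B) = 0 := by simp [hsSq]
    rw [this, mul_zero]
    linarith
  have hev : ∀ᶠ A in nhdsWithin B {A | A.PosSemidef}, δ ^ (s - 2) * hsSq (A - B) < ε / 2 :=
    (hcont.continuousAt.eventually_lt continuousAt_const h0).filter_mono nhdsWithin_le_nhds
  filter_upwards [hev, self_mem_nhdsWithin] with A hA1 hA2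
  rw [Real.dist_eq]
  refine (abs_powTr_sub_powTr_le hA2 hB hs hs1 hδ0).trans_lt ?_
  have h1 : N * δ ^ s ≤ ε / 2 := by
    rw [hδs, ← mul_div_assoc, div_le_div_iff₀ (by positivity) two_pos]
    nlinarith
  linarith

theorem isClosed_posSemidef : IsClosed {A : Matrix n n ℂ | A.PosSemidef} := by
  have : {A : Matrix n n ℂ | A.PosSemidef} = {A | Aᴴ = A} ∩
      ⋂ x : n → ℂ, {A | 0 ≤ star x ⬝ᵥ A *ᵥ x} := by
    ext A
    simp only [Set.mem_ofPred_eq, Set.mem_inter_iff, Set.mem_iInter]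
    exact posSemidef_iff_dotProduct_mulVec
  rw [this]
  refine IsClosed.inter (isClosed_eq continuous_id.matrix_conjTranspose continuous_id)
    (isClosed_iInter fun x => ?_)
  refine isClosed_le continuous_const ?_
  exact Continuous.dotProduct continuous_const (continuous_id.matrix_mulVec continuous_const)

theorem norm_apply_le_one {A : Matrix n n ℂ} (hA : A.PosSemidef) (h1 : A.trace = 1) (i j : n) :
    ‖A i j‖ ≤ 1 := by
  obtain ⟨U, d, h⟩ := exists_isSpectral hA.isHermitian
  refine (norm_apply_le_sqrt_hsSq A i j).trans ?_
  rw [Real.sqrt_le_left zero_le_one, one_pow]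
  have h2 : ∑ i, d i = 1 := by
    rw [← h.trace_re, h1, Complex.one_re]
  have h3 : hsSq A = ∑ i, d i * d i := by
    have e1 := trace_conjTranspose_mul_self_eq_hsSq A
    have e2 : Aᴴ * A = U * diagonal (fun i => ((d i * d i : ℝ) : ℂ)) * Uᴴ := by
      rw [hA.isHermitian.eq]
      nth_rewrite 2 [h.2]
      rw [← Matrix.mul_assoc, ← Matrix.mul_assoc, h.mul_eq, Matrix.mul_assoc U,
        diagonal_mul_diagonal]
      simp
    have e3 : IsSpectral (Aᴴ * A) U (fun i => d i * d i) := ⟨h.1, e2⟩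
    rw [e3.trace] at e1
    exact_mod_cast e1.symm
  rw [h3, ← h2]
  refine Finset.sum_le_sum fun i _ => ?_
  have h4 : d i ≤ ∑ j, d j := Finset.single_le_sum (fun j _ => h.nonneg hA j) (Finset.mem_univ i)
  have h5 := h.nonneg hA i
  nlinarith

theorem isCompact_densityMatrices : IsCompact {A : Matrix n n ℂ | A.PosSemidef ∧ A.trace = 1} := by
  have h1 : IsCompact {A : Matrix n n ℂ | ∀ i, A i ∈ {v : n → ℂ | ∀ j, v j ∈ Metric.closedBall 0 1}} :=
    isCompact_pi_infinite fun i => isCompact_pi_infinite fun j => isCompact_closedBall 0 1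
  refine h1.of_isClosed_subset ?_ ?_
  · exact isClosed_posSemidef.inter (isClosed_eq continuous_id.matrix_trace continuous_const)
  · intro A hA i j
    simpa using norm_apply_le_one hA.1 hA.2 i j

theorem trace_re_pos {A : Matrix n n ℂ} (hA : A.PosSemidef) (h0 : A ≠ 0) : 0 < A.trace.re := by
  rw [← powTr_one hA]
  exact powTr_pos hA h0 1

theorem trace_eq_ofReal_re {A : Matrix n n ℂ} (hA : A.PosSemidef) : A.trace = (A.trace.re : ℂ) := by
  obtain ⟨U, d, h⟩ := exists_isSpectral hA.isHermitian
  rw [h.trace, Complex.ofReal_re]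

/-- The quotient `Tr Φ(σ)^α / (Tr σ^γ)^(α/γ)` attains its minimum. -/
theorem exists_min_powTr_krausMap [Nonempty a] (K : b → Matrix a n ℂ) {α γ : ℝ} (hα : 0 < α)
    (hα1 : α ≤ 1) (hγ : 0 < γ) (hγ1 : γ ≤ 1) :
    ∃ σ₀ : Matrix a a ℂ, σ₀.PosSemidef ∧ σ₀.trace = 1 ∧ ∀ σ : Matrix a a ℂ, σ.PosSemidef →
      powTr α (krausMap K σ₀) * powTr γ σ ^ (α / γ) ≤
        powTr α (krausMap K σ) * powTr γ σ₀ ^ (α / γ) := by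
  set D : Set (Matrix a a ℂ) := {A | A.PosSemidef ∧ A.trace = 1} with hD
  have hne0 : ∀ A ∈ D, A ≠ 0 := by
    rintro A ⟨_, h1⟩ rfl
    simp at h1
  have hpos : ∀ A ∈ D, 0 < powTr γ A ^ (α / γ) := fun A hA =>
    Real.rpow_pos_of_pos (powTr_pos hA.1 (hne0 A hA) γ) _
  have hKc : Continuous (krausMap K) := by
    unfold krausMap
    fun_prop
  have hcont : ContinuousOn
      (fun σ => powTr α (krausMap K σ) / powTr γ σ ^ (α / γ)) D := by
    refine ContinuousOn.div ?_ ?_ fun A hA => (hpos A hA).ne'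
    · exact (continuousOn_powTr hα hα1).comp hKc.continuousOn
        fun A hA => krausMap_posSemidef K hA.1
    · refine ContinuousOn.rpow_const ?_ fun A hA => Or.inr (by positivity)
      exact (continuousOn_powTr hγ hγ1).mono fun A hA => hA.1
  have hDne : D.Nonempty := by
    obtain ⟨i⟩ := ‹Nonempty a›
    refine ⟨diagonal (Pi.single i 1), PosSemidef.diagonal ?_, ?_⟩
    · intro j
      by_cases hj : j = i
      · subst hj; simp
      · simp [hj]
    · simp [trace_diagonal]
  obtain ⟨σ₀, hσ₀, hmin⟩ := isCompact_densityMatrices.exists_isMinOn hDne hcont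
  refine ⟨σ₀, hσ₀.1, hσ₀.2, fun σ hσ => ?_⟩
  by_cases h0 : σ = 0
  · have e1 : krausMap K 0 = 0 := by simp [krausMap]
    rw [h0, e1, powTr_zero hγ.ne', powTr_zero hα.ne', Real.zero_rpow (by positivity)]
    simp
  have htr := trace_re_pos hσ h0
  set t := σ.trace.re with ht
  -- The quotient has degree zero, so minimality over density matrices extends to every nonzero `σ`
  -- by normalising the trace.
  set ρ : Matrix a a ℂ := ((t⁻¹ : ℝ) : ℂ) • σ with hρ
  have hρp : ρ.PosSemidef := hσ.smul (by exact_mod_cast (inv_pos.2 htr).le)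
  have hρD : ρ ∈ D := by
    refine ⟨hρp, ?_⟩
    rw [hρ, trace_smul, trace_eq_ofReal_re hσ, smul_eq_mul, ← Complex.ofReal_mul, ← ht,
      inv_mul_cancel₀ htr.ne', Complex.ofReal_one]
  have h1 : powTr α (krausMap K σ₀) / powTr γ σ₀ ^ (α / γ) ≤
    powTr α (krausMap K ρ) / powTr γ ρ ^ (α / γ) := hmin hρD
  rw [div_le_div_iff₀ (hpos _ hσ₀) (hpos _ hρD), hρ, krausMap_smul,
    powTr_smul hσ (inv_pos.2 htr).le, powTr_smul (krausMap_posSemidef K hσ) (inv_pos.2 htr).le,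
    Real.mul_rpow (by positivity) (powTr_nonneg hσ _), ← Real.rpow_mul (inv_pos.2 htr).le,
    mul_div_cancel₀ _ hγ.ne'] at h1
  have h2 : 0 < t⁻¹ ^ α := by positivity
  refine le_of_mul_le_mul_left ?_ h2
  linarith

theorem powTr_le_powTr_rpow {σ : Matrix n n ℂ} (hσ : σ.PosSemidef) {α γ : ℝ} (hγ : 0 < γ)
    (hγα : γ ≤ α) : powTr α σ ≤ powTr γ σ ^ (α / γ) := by
  obtain ⟨U, d, h⟩ := exists_isSpectral hσ.isHermitian
  have hθ : 1 ≤ α / γ := (one_le_div hγ).2 hγα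
  rw [h.powTr, h.powTr]
  have e1 : ∀ i, d i ^ α = (d i ^ γ) ^ (α / γ) := fun i => by
    rw [← Real.rpow_mul (h.nonneg hσ i), mul_div_cancel₀ _ hγ.ne']
  simp only [e1]
  have key : ∀ s : Finset n, ∑ i ∈ s, (d i ^ γ) ^ (α / γ) ≤ (∑ i ∈ s, d i ^ γ) ^ (α / γ) := by
    intro s
    induction s using Finset.induction_on with
    | empty => simp [Real.zero_rpow (by linarith : α / γ ≠ 0)]
    | insert i s hi ih =>
      rw [Finset.sum_insert hi, Finset.sum_insert hi]
      have h1 := Real.rpow_nonneg (h.nonneg hσ i) γ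
      have h2 : 0 ≤ ∑ i ∈ s, d i ^ γ :=
        Finset.sum_nonneg fun i _ => Real.rpow_nonneg (h.nonneg hσ i) γ
      exact (add_le_add le_rfl ih).trans (Real.add_rpow_le_rpow_add h1 h2 hθ)
  exact key _

/-- The power mean inequality. With `powTr_le_powTr_rpow` it traps `(Tr σ^γ)^(α/γ)` between `Tr σ^α`
and a dimension factor times it; the factor does not depend on `σ` and tends to one as `γ → α`. -/
theorem powTr_rpow_le_card_mul {σ : Matrix n n ℂ} (hσ : σ.PosSemidef) {α γ : ℝ} (hγ : 0 < γ)
    (hγα : γ ≤ α) : powTr γ σ ^ (α / γ) ≤ (Fintype.card n : ℝ) ^ (α / γ - 1) * powTr α σ := by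
  obtain ⟨U, d, h⟩ := exists_isSpectral hσ.isHermitian
  have hθ : 1 ≤ α / γ := (one_le_div hγ).2 hγα
  rw [h.powTr, h.powTr]
  have e1 : ∀ i, d i ^ α = (d i ^ γ) ^ (α / γ) := fun i => by
    rw [← Real.rpow_mul (h.nonneg hσ i), mul_div_cancel₀ _ hγ.ne']
  simp only [e1]
  exact Real.rpow_sum_le_const_mul_sum_rpow_of_nonneg Finset.univ hθ
    fun i _ => Real.rpow_nonneg (h.nonneg hσ i) γ

end Compactness

/-! ### Full-rank minimisers, critical equations, and sufficiency of criticality. -/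

section Multiplicativity

variable {a b n : Type*} [Fintype a] [DecidableEq a] [Fintype b] [Fintype n] [DecidableEq n]

/-- `S` dominates a positive multiple of the identity. Invertibility of `Φ(S)` is needed for the
power `Z^(1-p)`. -/
theorem krausMap_posDef (K : b → Matrix a n ℂ) (hK : (krausMap K 1).PosDef) {S : Matrix a a ℂ}
    (hS : S.PosDef) : (krausMap K S).PosDef := by
  obtain ⟨U, d, h⟩ := exists_isSpectral hS.isHermitian
  obtain ⟨m, hm, hmd⟩ := exists_pos_forall_le (h.pos hS)
  have h1 : (S - (m : ℂ) • 1).PosSemidef :=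
    (h.sub_smul_one m).posSemidef fun i => sub_nonneg.2 (hmd i)
  have h2 : krausMap K S = (m : ℂ) • krausMap K 1 + krausMap K (S - (m : ℂ) • 1) := by
    rw [krausMap_sub, krausMap_smul]
    abel
  rw [h2]
  exact (hK.smul (by exact_mod_cast hm)).add_posSemidef (krausMap_posSemidef K h1)

/-- `τ ↦ Tr Φ(τ^p)^(1/p)` is subadditive. -/
theorem powTr_krausMap_mpow_add_le {p : ℝ} (hp : 1 < p) (hp2 : p ≤ 2) (K : b → Matrix a n ℂ)
    {τ τ' : Matrix a a ℂ} (hτ : τ.PosSemidef) (hτ' : τ'.PosSemidef) :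
    powTr (1 / p) (krausMap K (mpow (τ + τ') p)) ≤
      powTr (1 / p) (krausMap K (mpow τ p)) + powTr (1 / p) (krausMap K (mpow τ' p)) := by
  have hX := krausMap_posSemidef K (mpow_posSemidef hτ p)
  have hX' := krausMap_posSemidef K (mpow_posSemidef hτ' p)
  refine le_of_forall_pos_le_add fun ε hε => ?_
  -- With `Z` and `Z'` nearly optimal for the summands, `Z + Z'` is a test matrix for the sum.
  obtain ⟨Z, hZ, h1⟩ := exists_trace_mul_mpow_le hX hp (half_pos hε)
  obtain ⟨Z', hZ', h2⟩ := exists_trace_mul_mpow_le hX' hp (half_pos hε)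
  have h3 := trace_krausMap_mpow_add_le hp hp2 hτ hτ' hZ hZ' K
  have h4 := klein_mpow_inv (krausMap_posSemidef K (mpow_posSemidef (hτ.add hτ') p))
    (hZ.add hZ') hp
  rw [trace_add, Complex.add_re] at h4
  nlinarith

/-- The rank-one spectral projection. -/
theorem isSpectral_single {A U : Matrix a a ℂ} {d : a → ℝ} (h : IsSpectral A U d) (i : a) (t : ℝ) :
    IsSpectral (U * diagonal (fun j => ((if j = i then t else 0 : ℝ) : ℂ)) * Uᴴ) U
      (fun j => if j = i then t else 0) := ⟨h.1, rfl⟩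

theorem IsSpectral.add {A B U : Matrix a a ℂ} {d e : a → ℝ} (h : IsSpectral A U d)
    (h' : IsSpectral B U e) : IsSpectral (A + B) U (fun i => d i + e i) := by
  refine ⟨h.1, ?_⟩
  have : diagonal (fun i => ((d i + e i : ℝ) : ℂ)) =
      diagonal (fun i => (d i : ℂ)) + diagonal (fun i => (e i : ℂ)) := by
    rw [diagonal_add]
    simp
  rw [this, Matrix.mul_add, Matrix.add_mul, ← h.2, ← h'.2]

/-- As `t → 0` the smaller exponent dominates; the witness solves `t^(α-γ) = C / (2(D+1))`, where `D
+ 1` covers `D = 0`. -/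
theorem not_forall_mul_rpow_le {γ α C D : ℝ} (hγα : γ < α) (hC : 0 < C) (hD : 0 ≤ D) :
    ¬ ∀ t : ℝ, 0 < t → C * t ^ γ ≤ t ^ α * D := by
  intro key
  set t := (C / (2 * (D + 1))) ^ (1 / (α - γ)) with ht
  have ht0 : 0 < t := by positivity
  have hte : t ^ (α - γ) = C / (2 * (D + 1)) := by
    rw [ht, ← Real.rpow_mul (by positivity), one_div_mul_cancel (by linarith), Real.rpow_one]
  have h2 := key t ht0
  have h3 : t ^ α = t ^ γ * t ^ (α - γ) := by
    rw [← Real.rpow_add ht0, add_sub_cancel]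
  rw [h3, hte, mul_comm C, mul_assoc] at h2
  have h5 : C ≤ C / (2 * (D + 1)) * D := le_of_mul_le_mul_left h2 (by positivity)
  rw [div_mul_eq_mul_div, le_div_iff₀ (by positivity)] at h5
  nlinarith

/-- For `γ < α` the minimisers of `Tr Φ(σ)^α / (Tr σ^γ)^(α/γ)` have full rank. -/
theorem posDef_of_isMin {p γ C : ℝ} (hp : 1 < p) (hp2 : p ≤ 2) (hγ : 0 < γ) (hγp : γ < 1 / p)
    (hC : 0 < C) (K : b → Matrix a n ℂ) {σ₀ : Matrix a a ℂ} (hσ₀ : σ₀.PosSemidef)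
    (h1 : powTr γ σ₀ = 1) (hval : powTr (1 / p) (krausMap K σ₀) = C)
    (hmin : ∀ σ : Matrix a a ℂ, σ.PosSemidef →
      C * powTr γ σ ^ (1 / p / γ) ≤ powTr (1 / p) (krausMap K σ)) : σ₀.PosDef := by
  obtain ⟨U, d, h⟩ := exists_isSpectral hσ₀.isHermitian
  refine h.posDef fun i => (h.nonneg hσ₀ i).lt_of_ne' fun hi => ?_
  have hα : 0 < 1 / p := by positivity
  have hP := isSpectral_single h i 1
  set P := U * diagonal (fun j => ((if j = i then 1 else 0 : ℝ) : ℂ)) * Uᴴ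
  have hPp : P.PosSemidef := hP.posSemidef fun j => by split_ifs <;> norm_num
  set D := powTr (1 / p) (krausMap K P) with hD
  have hD0 : 0 ≤ D := powTr_nonneg (krausMap_posSemidef K hPp) _
  -- Compare the value at `σ₀ + t P`, with `P` a projection in the kernel of `σ₀`. Powers add
  -- because `σ₀` and `P` are diagonal in one basis with disjoint supports, so subadditivity bounds
  -- the numerator by `C + t^(1/p) D`, while minimality forces at least `C (1 + t^γ)`.
  have key : ∀ t : ℝ, 0 < t → C * t ^ γ ≤ t ^ (1 / p) * D := by
    intro t ht
    have htP : ((t : ℂ) • P).PosSemidef := hPp.smul (by exact_mod_cast ht.le)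
    have hsum := h.add (hP.smul t)
    have e1 : mpow (σ₀ + (t : ℂ) • P) (1 / p) = mpow σ₀ (1 / p) + mpow ((t : ℂ) • P) (1 / p) := by
      refine (hsum.mpow _).eq (((h.mpow _).add ((hP.smul t).mpow _)).congr fun j => ?_)
      by_cases hj : j = i
      · simp [hj, hi, Real.zero_rpow (inv_ne_zero (by linarith : p ≠ 0))]
      · simp [hj, Real.zero_rpow (inv_ne_zero (by linarith : p ≠ 0))]
    have hpp : 1 / p * p = 1 := one_div_mul_cancel (by linarith)
    have h2 := powTr_krausMap_mpow_add_le hp hp2 K (mpow_posSemidef hσ₀ (1 / p))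
      (mpow_posSemidef htP (1 / p))
    rw [← e1, mpow_mpow (hσ₀.add htP), mpow_mpow hσ₀, mpow_mpow htP, hpp, mpow_one hσ₀,
      mpow_one htP, mpow_one (hσ₀.add htP), hval, krausMap_smul K (t : ℂ) P,
      powTr_smul (krausMap_posSemidef K hPp) ht.le, ← hD] at h2
    have h3 := hmin _ (hσ₀.add htP)
    have e2 : powTr γ (σ₀ + (t : ℂ) • P) = 1 + t ^ γ := by
      have hd1 := h.powTr γ
      rw [h1] at hd1
      rw [hsum.powTr]
      have : ∀ j, (d j + t * if j = i then 1 else 0) ^ γ = d j ^ γ + if j = i then t ^ γ else 0 := by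
        intro j
        by_cases hj : j = i
        · simp [hj, hi, Real.zero_rpow hγ.ne']
        · simp [hj]
      simp only [this, Finset.sum_add_distrib, Finset.sum_ite_eq', Finset.mem_univ, if_true, ← hd1]
    rw [e2] at h3
    have h4 : 1 + t ^ γ ≤ (1 + t ^ γ) ^ (1 / p / γ) := by
      have h5 : 0 ≤ t ^ γ := by positivity
      exact Real.self_le_rpow_of_one_le (by linarith) ((one_le_div hγ).2 hγp.le)
    nlinarith [mul_le_mul_of_nonneg_left h4 hC.le]
  exact absurd key (not_forall_mul_rpow_le hγp hC hD0)

/-- A minimiser over the normalised positive semidefinite matrices of the linear functional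
`σ ↦ Tr σ T` is determined by `T`. -/
theorem eq_smul_mpow_of_isMin [Nonempty a] {γ c : ℝ} (hγ : 0 < γ) (hγ1 : γ < 1)
    {T σ₀ : Matrix a a ℂ} (hT : T.PosDef) (hσ₀ : σ₀.PosDef) (h1 : powTr γ σ₀ = 1)
    (hval : (σ₀ * T).trace.re = c)
    (hmin : ∀ σ : Matrix a a ℂ, σ.PosSemidef → powTr γ σ = 1 → c ≤ (σ * T).trace.re) :
    T = (c : ℂ) • mpow σ₀ (γ - 1) := by
  have hP : 1 < 1 / γ := (one_lt_div hγ).2 hγ1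
  -- Since `e * (1 - 1/γ) = 1`, the matrix `T` is proportional to `W^(1-1/γ)` with `W` of trace one,
  -- the form required by the reverse Hölder inequality of exponent `1/γ`.
  set e := -γ / (1 - γ) with he
  set k := powTr e T with hk
  have hk0 : 0 < k := by
    refine powTr_pos hT.posSemidef ?_ e
    rintro rfl
    have := hT.trace_pos
    simp at this
  have hTe := mpow_posSemidef hT.posSemidef e
  set W : Matrix a a ℂ := ((k⁻¹ : ℝ) : ℂ) • mpow T e with hW
  have hWp : W.PosDef := (mpow_posDef hT e).smul (by exact_mod_cast inv_pos.2 hk0)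
  have hW1 : W.trace.re = 1 := by
    rw [hW, trace_smul, smul_eq_mul, Complex.re_ofReal_mul, ← powTr, ← hk,
      inv_mul_cancel₀ hk0.ne']
  set κ := k ^ (1 - 1 / γ) with hκ
  have hκ0 : 0 < κ := by positivity
  have hWT : mpow W (1 - 1 / γ) = ((κ⁻¹ : ℝ) : ℂ) • T := by
    rw [hW, mpow_smul hTe (inv_pos.2 hk0).le, mpow_mpow hT.posSemidef, Real.inv_rpow hk0.le]
    have : e * (1 - 1 / γ) = 1 := by
      rw [he]
      have : 1 - γ ≠ 0 := by linarith
      field_simp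
      ring
    rw [this, mpow_one hT.posSemidef]
  have hT2 : T = (κ : ℂ) • mpow W (1 - 1 / γ) := by
    rw [hWT, smul_smul, ← Complex.ofReal_mul, mul_inv_cancel₀ hκ0.ne', Complex.ofReal_one,
      one_smul]
  have hγγ : 1 / (1 / γ) = γ := one_div_one_div γ
  have h2 : 1 ≤ κ⁻¹ * c := by
    have := powTr_rpow_le hσ₀.posSemidef hWp hP hW1
    rw [hγγ, h1, Real.one_rpow, hWT, Matrix.mul_smul, trace_smul, smul_eq_mul,
      Complex.re_ofReal_mul, hval] at this
    exact this
  have h3 : c ≤ κ := by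
    have := hmin (mpow W (1 / γ)) (mpow_posSemidef hWp.posSemidef _) (by
      rw [powTr_mpow hWp.posSemidef, one_div_mul_cancel hγ.ne', powTr_one hWp.posSemidef, hW1])
    rw [hT2, Matrix.mul_smul, trace_smul, smul_eq_mul, Complex.re_ofReal_mul,
      mpow_mul_mpow hWp, add_sub_cancel, mpow_one hWp.posSemidef, hW1, mul_one] at this
    exact this
  -- Reverse Hölder at `σ₀` gives `κ ≤ c`, and the competitor `W^(1/γ)` gives `c ≤ κ`; the equality
  -- case then identifies `σ₀^γ` with `W`.
  have h4 : κ = c := by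
    rw [inv_mul_eq_div, le_div_iff₀ hκ0, one_mul] at h2
    exact le_antisymm h2 h3
  have h5 : mpow σ₀ γ = W := by
    have := mpow_eq_of_trace_le hσ₀.posSemidef hWp hP hW1 (by rw [hγγ, h1]) (by
      rw [hWT, Matrix.mul_smul, trace_smul, smul_eq_mul, Complex.re_ofReal_mul, hval, h4,
        inv_mul_cancel₀ (h4 ▸ hκ0.ne')])
    rwa [hγγ] at this
  rw [hT2, h4, ← h5, mpow_mpow hσ₀.posSemidef]
  congr 2
  field_simp

/-- For `γ < α`, a minimiser of `Tr Φ(σ)^α / (Tr σ^γ)^(α/γ)` yields a positive definite critical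
point of the jointly convex functional `(τ, Z) ↦ Tr Φ(τ^p) Z^(1-p)`. -/
theorem exists_critical_point [Nonempty a] {p γ C : ℝ} (hp : 1 < p) (hp2 : p ≤ 2) (hγ : 0 < γ)
    (hγp : γ < 1 / p) (hC : 0 < C) (K : b → Matrix a n ℂ) (hK : (krausMap K 1).PosDef)
    {σ₀ : Matrix a a ℂ} (hσ₀ : σ₀.PosSemidef) (h1 : powTr γ σ₀ = 1)
    (hval : powTr (1 / p) (krausMap K σ₀) = C)
    (hmin : ∀ σ : Matrix a a ℂ, σ.PosSemidef →
      C * powTr γ σ ^ (1 / p / γ) ≤ powTr (1 / p) (krausMap K σ)) :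
    ∃ (τ₀ : Matrix a a ℂ) (Z₀ : Matrix n n ℂ), τ₀.PosDef ∧ Z₀.PosDef ∧
      powTr (γ * p) τ₀ = 1 ∧ krausMap K (mpow τ₀ p) = ((C ^ p : ℝ) : ℂ) • mpow Z₀ p ∧
      krausAdjoint K (mpow Z₀ (1 - p)) = ((C ^ p : ℝ) : ℂ) • mpow τ₀ (γ * p - p) := by
  have hσp := posDef_of_isMin hp hp2 hγ hγp hC K hσ₀ h1 hval hmin
  have hp0 : p ≠ 0 := by linarith
  have hpp : 1 / p * p = 1 := one_div_mul_cancel hp0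
  have hγ1 : γ < 1 := hγp.trans ((div_lt_one (by linarith)).2 hp)
  set X := krausMap K σ₀ with hX
  have hXp : X.PosDef := krausMap_posDef K hK hσp
  -- The optimal `Z` for `X = Φ(σ₀)`. With it frozen, `σ₀` also minimises the linear functional `σ ↦
  -- Tr σ T`, because reverse Hölder is an equality there; this yields the second critical equation.
  set Z : Matrix n n ℂ := ((C⁻¹ : ℝ) : ℂ) • mpow X (1 / p) with hZ
  have hZp : Z.PosDef := (mpow_posDef hXp _).smul (by exact_mod_cast inv_pos.2 hC)
  have hZ1 : Z.trace.re = 1 := by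
    rw [hZ, trace_smul, smul_eq_mul, Complex.re_ofReal_mul, ← powTr, hval, inv_mul_cancel₀ hC.ne']
  have hXZ : X = ((C ^ p : ℝ) : ℂ) • mpow Z p := by
    rw [hZ, mpow_smul (mpow_posSemidef hXp.posSemidef _) (inv_pos.2 hC).le,
      mpow_mpow hXp.posSemidef, hpp, mpow_one hXp.posSemidef, smul_smul, ← Complex.ofReal_mul,
      Real.inv_rpow hC.le, mul_inv_cancel₀ (by positivity), Complex.ofReal_one, one_smul]
  set T := krausAdjoint K (mpow Z (1 - p)) with hT
  have hlow : ∀ σ : Matrix a a ℂ, σ.PosSemidef → powTr γ σ = 1 → C ^ p ≤ (σ * T).trace.re := by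
    intro σ hσ hσ1
    rw [hT, ← trace_krausMap_mul]
    refine le_trans ?_ (powTr_rpow_le (krausMap_posSemidef K hσ) hZp hp hZ1)
    have := hmin σ hσ
    rw [hσ1, Real.one_rpow, mul_one] at this
    exact Real.rpow_le_rpow hC.le this (by linarith)
  have hTs : T.PosSemidef := krausAdjoint_posSemidef K (mpow_posSemidef hZp.posSemidef _)
  -- Testing the lower bound on rank-one spectral projections of `T` shows that each eigenvalue is
  -- at least `C^p`.
  have hTp : T.PosDef := by
    obtain ⟨U, d, h⟩ := exists_isSpectral hTs.isHermitian
    refine h.posDef fun i => ?_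
    have hP := isSpectral_single h i 1
    have h2 := hlow _ (hP.posSemidef fun j => by split_ifs <;> norm_num) (by
      rw [hP.powTr]
      have : ∀ j, (if j = i then (1 : ℝ) else 0) ^ γ = if j = i then 1 else 0 := fun j => by
        split_ifs <;> simp [Real.zero_rpow hγ.ne']
      simp [this])
    have h3 : (U * diagonal (fun j => ((if j = i then 1 else 0 : ℝ) : ℂ)) * Uᴴ * T).trace.re
        = d i := by
      rw [Matrix.mul_assoc, h.conj_eq, ← Matrix.mul_assoc, trace_mul_comm, ← Matrix.mul_assoc,
        ← Matrix.mul_assoc, h.1, Matrix.one_mul, diagonal_mul_diagonal, trace_diagonal]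
      simp
    rw [h3] at h2
    exact lt_of_lt_of_le (by positivity) h2
  have hval2 : (σ₀ * T).trace.re = C ^ p := by
    rw [hT, ← trace_krausMap_mul, ← hX, hXZ, Matrix.smul_mul, trace_smul, smul_eq_mul,
      Complex.re_ofReal_mul, mpow_mul_mpow hZp, add_sub_cancel, mpow_one hZp.posSemidef, hZ1,
      mul_one]
  have hTeq := eq_smul_mpow_of_isMin hγ hγ1 hTp hσp h1 hval2 hlow
  refine ⟨mpow σ₀ (1 / p), Z, mpow_posDef hσp _, hZp, ?_, ?_, ?_⟩
  · rw [powTr_mpow hσ₀, show 1 / p * (γ * p) = γ by field_simp, h1]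
  · rw [mpow_mpow hσ₀, hpp, mpow_one hσ₀, ← hXZ]
  · rw [← hT, hTeq, mpow_mpow hσ₀]
    congr 2
    field_simp

variable {a' b' n' : Type*} [Fintype a'] [DecidableEq a'] [Fintype b'] [Fintype n'] [DecidableEq n']

/-- The Kraus operators of a tensor product. -/
def krausTensor (K : b → Matrix a n ℂ) (K' : b' → Matrix a' n' ℂ) :
    b × b' → Matrix (a × a') (n × n') ℂ := fun y => K y.1 ⊗ₖ K' y.2

theorem sum_kronecker_sum {l m l' m' : Type*} (A : b → Matrix l m ℂ) (B : b' → Matrix l' m' ℂ) :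
    ∑ y : b × b', A y.1 ⊗ₖ B y.2 = (∑ y, A y) ⊗ₖ (∑ y, B y) := by
  ext i j
  simp only [Matrix.sum_apply, kroneckerMap_apply, Fintype.sum_prod_type, Finset.sum_mul_sum]

theorem krausMap_kronecker (K : b → Matrix a n ℂ) (K' : b' → Matrix a' n' ℂ) (S : Matrix a a ℂ)
    (S' : Matrix a' a' ℂ) :
    krausMap (krausTensor K K') (S ⊗ₖ S') = krausMap K S ⊗ₖ krausMap K' S' := by
  rw [krausMap, krausMap, krausMap, ← sum_kronecker_sum]
  refine Finset.sum_congr rfl fun y _ => ?_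
  rw [krausTensor, conjTranspose_kronecker, ← mul_kronecker_mul, ← mul_kronecker_mul]

theorem krausAdjoint_kronecker (K : b → Matrix a n ℂ) (K' : b' → Matrix a' n' ℂ)
    (W : Matrix n n ℂ) (W' : Matrix n' n' ℂ) :
    krausAdjoint (krausTensor K K') (W ⊗ₖ W') = krausAdjoint K W ⊗ₖ krausAdjoint K' W' := by
  rw [krausAdjoint, krausAdjoint, krausAdjoint, ← sum_kronecker_sum]
  refine Finset.sum_congr rfl fun y _ => ?_
  rw [krausTensor, conjTranspose_kronecker, ← mul_kronecker_mul, ← mul_kronecker_mul]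

/-- A positive definite critical point is a global minimiser. -/
theorem le_powTr_krausMap_of_critical {p γ C : ℝ} (hp : 1 < p) (hp2 : p ≤ 2) (hγ : 0 < γ)
    (hγp : γ < 1 / p) (hC : 0 < C) (K : b → Matrix a n ℂ) (hK : (krausMap K 1).PosDef)
    {τ₀ : Matrix a a ℂ} {Z₀ : Matrix n n ℂ} (hτ₀ : τ₀.PosDef) (hZ₀ : Z₀.PosDef)
    (h1 : powTr (γ * p) τ₀ = 1) (hK1 : krausMap K (mpow τ₀ p) = ((C ^ p : ℝ) : ℂ) • mpow Z₀ p)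
    (hK2 : krausAdjoint K (mpow Z₀ (1 - p)) = ((C ^ p : ℝ) : ℂ) • mpow τ₀ (γ * p - p))
    {σ : Matrix a a ℂ} (hσ : σ.PosDef) (hσ1 : powTr γ σ = 1)
    (hX0 : krausMap K σ ≠ 0) : C ≤ powTr (1 / p) (krausMap K σ) := by
  have hp0 : p ≠ 0 := by linarith
  have hpp : 1 / p * p = 1 := one_div_mul_cancel hp0
  set X := krausMap K σ with hX
  have hXp : X.PosDef := krausMap_posDef K hK hσ
  set Y := powTr (1 / p) X with hY
  have hY0 : 0 < Y := powTr_pos hXp.posSemidef hX0 _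
  set Z : Matrix n n ℂ := ((Y⁻¹ : ℝ) : ℂ) • mpow X (1 / p) with hZ
  have hZp : Z.PosDef := (mpow_posDef hXp _).smul (by exact_mod_cast inv_pos.2 hY0)
  have hZ1 : Z.trace.re = 1 := by
    rw [hZ, trace_smul, smul_eq_mul, Complex.re_ofReal_mul, ← powTr, ← hY, inv_mul_cancel₀ hY0.ne']
  have hXZ : X = ((Y ^ p : ℝ) : ℂ) • mpow Z p := by
    rw [hZ, mpow_smul (mpow_posSemidef hXp.posSemidef _) (inv_pos.2 hY0).le,
      mpow_mpow hXp.posSemidef, hpp, mpow_one hXp.posSemidef, smul_smul, ← Complex.ofReal_mul,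
      Real.inv_rpow hY0.le, mul_inv_cancel₀ (by positivity), Complex.ofReal_one, one_smul]
  have hτ := mpow_posDef hσ (1 / p)
  -- With `Z` optimal for `Φ(σ)`, the right side of the tangent inequality is exactly `Y^p`.
  have h2 := tangent_le_trace_krausMap hp hp2 (by positivity : 0 ≤ C ^ p) K hτ₀ hτ hZ₀ hZp hK1 hK2
  rw [mpow_mpow hσ.posSemidef, hpp, mpow_one hσ.posSemidef, ← hX] at h2
  have h3 : (X * mpow Z (1 - p)).trace.re = Y ^ p := by
    rw [hXZ, Matrix.smul_mul, trace_smul, smul_eq_mul, Complex.re_ofReal_mul, mpow_mul_mpow hZp,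
      add_sub_cancel, mpow_one hZp.posSemidef, hZ1, mul_one]
  have hr0 : 0 < γ * p := by positivity
  have hr1 : γ * p < 1 := (lt_div_iff₀ (by linarith)).1 hγp
  have h4 : 1 ≤ (mpow σ (1 / p) * mpow τ₀ (γ * p - 1)).trace.re := by
    -- A second reverse Hölder inequality, of exponent `1/(γp)` and with weight matrix `τ₀^(γp)`; it
    -- makes the tangent at least `C^p`.
    have h5 := powTr_rpow_le hτ.posSemidef (mpow_posDef hτ₀ (γ * p))
      ((one_lt_div hr0).2 hr1) (by rw [← h1, powTr])
    have e1 : powTr (1 / (1 / (γ * p))) (mpow σ (1 / p)) = 1 := by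
      rw [powTr_mpow hσ.posSemidef, show 1 / p * (1 / (1 / (γ * p))) = γ by field_simp, hσ1]
    have e2 : γ * p * (1 - 1 / (γ * p)) = γ * p - 1 := by field_simp
    rw [e1, Real.one_rpow, mpow_mpow hτ₀.posSemidef, e2] at h5
    exact h5
  rw [h3, hZ1, mul_one] at h2
  have h6 : C ^ p ≤ Y ^ p := by
    refine le_trans ?_ h2
    have : 1 ≤ p * (mpow σ (1 / p) * mpow τ₀ (γ * p - 1)).trace.re + (1 - p) := by nlinarith
    nlinarith [Real.rpow_nonneg hC.le p]
  exact (Real.rpow_le_rpow_iff hC.le hY0.le (by linarith)).1 h6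

end Multiplicativity

/-! ### Multiplicativity for `γ < α`, then the limit `γ → α`. -/

section Multiplicativity

variable {a b n : Type*} [Fintype a] [DecidableEq a] [Fintype b] [Fintype n] [DecidableEq n]
variable {a' b' n' : Type*} [Fintype a'] [DecidableEq a'] [Fintype b'] [Fintype n'] [DecidableEq n']

theorem exists_normalization {γ : ℝ} (hγ : 0 < γ) {σ : Matrix a a ℂ} (hσ : σ.PosSemidef)
    (h0 : σ ≠ 0) : ∃ t : ℝ, 0 < t ∧ powTr γ ((t : ℂ) • σ) = 1 ∧
      ∀ α : ℝ, t ^ α = (powTr γ σ ^ (α / γ))⁻¹ := by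
  have hpos := powTr_pos hσ h0 γ
  refine ⟨powTr γ σ ^ (-(1 / γ)), by positivity, ?_, fun α => ?_⟩
  · rw [powTr_smul hσ (by positivity), ← Real.rpow_mul hpos.le,
      show -(1 / γ) * γ = -1 by field_simp, Real.rpow_neg_one, inv_mul_cancel₀ hpos.ne']
  · rw [← Real.rpow_mul hpos.le, ← Real.rpow_neg hpos.le]
    congr 1
    ring

theorem PosDef.ne_zero [Nonempty n] {A : Matrix n n ℂ} (hA : A.PosDef) : A ≠ 0 := by
  rintro rfl
  simpa using hA.trace_pos

/-- Multiplicativity of the minimum of `Tr Φ(σ)^α / (Tr σ^γ)^(α/γ)` for `γ < α`. -/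
theorem mul_mul_le_powTr_krausTensor_of_lt [Nonempty a] [Nonempty a'] [Nonempty n] [Nonempty n']
    {p γ C C' : ℝ} (hp : 1 < p) (hp2 : p ≤ 2) (hγ : 0 < γ) (hγp : γ < 1 / p) (hC : 0 < C)
    (hC' : 0 < C') (K : b → Matrix a n ℂ) (K' : b' → Matrix a' n' ℂ)
    (hK : (krausMap K 1).PosDef) (hK' : (krausMap K' 1).PosDef)
    {σ₀ : Matrix a a ℂ} {σ₀' : Matrix a' a' ℂ} (hσ₀ : σ₀.PosSemidef) (hσ₀' : σ₀'.PosSemidef)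
    (h0 : σ₀ ≠ 0) (h0' : σ₀' ≠ 0)
    (hval : powTr (1 / p) (krausMap K σ₀) = C * powTr γ σ₀ ^ (1 / p / γ))
    (hval' : powTr (1 / p) (krausMap K' σ₀') = C' * powTr γ σ₀' ^ (1 / p / γ))
    (hmin : ∀ σ : Matrix a a ℂ, σ.PosSemidef →
      C * powTr γ σ ^ (1 / p / γ) ≤ powTr (1 / p) (krausMap K σ))
    (hmin' : ∀ σ : Matrix a' a' ℂ, σ.PosSemidef →
      C' * powTr γ σ ^ (1 / p / γ) ≤ powTr (1 / p) (krausMap K' σ))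
    {σ : Matrix (a × a') (a × a') ℂ} (hσ : σ.PosDef) :
    C * C' * powTr γ σ ^ (1 / p / γ) ≤ powTr (1 / p) (krausMap (krausTensor K K') σ) := by
  have hα : 0 < 1 / p := by positivity
  obtain ⟨t, ht, ht1, htα⟩ := exists_normalization hγ hσ₀ h0
  obtain ⟨t', ht', ht1', htα'⟩ := exists_normalization hγ hσ₀' h0'
  have hpos : 0 < powTr γ σ₀ ^ (1 / p / γ) := Real.rpow_pos_of_pos (powTr_pos hσ₀ h0 γ) _
  have hpos' : 0 < powTr γ σ₀' ^ (1 / p / γ) := Real.rpow_pos_of_pos (powTr_pos hσ₀' h0' γ) _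
  obtain ⟨τ, Z, hτ, hZ, h1, h2, h3⟩ := exists_critical_point hp hp2 hγ hγp hC K hK
    (hσ₀.smul (by exact_mod_cast ht.le : (0 : ℂ) ≤ (t : ℂ))) ht1 (by
      rw [krausMap_smul, powTr_smul (krausMap_posSemidef K hσ₀) ht.le, htα, hval, mul_left_comm,
        inv_mul_cancel₀ hpos.ne', mul_one]) hmin
  obtain ⟨τ', Z', hτ', hZ', h1', h2', h3'⟩ := exists_critical_point hp hp2 hγ hγp hC' K' hK'
    (hσ₀'.smul (by exact_mod_cast ht'.le : (0 : ℂ) ≤ (t' : ℂ))) ht1' (by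
      rw [krausMap_smul, powTr_smul (krausMap_posSemidef K' hσ₀') ht'.le, htα', hval', mul_left_comm,
        inv_mul_cancel₀ hpos'.ne', mul_one]) hmin'
  have hKK : (krausMap (krausTensor K K') 1).PosDef := by
    rw [← one_kronecker_one, krausMap_kronecker]
    exact hK.kronecker hK'
  have hne : σ ≠ 0 := PosDef.ne_zero hσ
  obtain ⟨s, hs, hs1, hsα⟩ := exists_normalization hγ hσ.posSemidef hne
  have hsσ : ((s : ℂ) • σ).PosDef := hσ.smul (by exact_mod_cast hs)
  -- Powers, `krausMap` and `krausAdjoint` all respect tensor products, so the product pair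
  -- satisfies the critical equations with constant `(C C')^p`.
  have key := le_powTr_krausMap_of_critical hp hp2 hγ hγp (mul_pos hC hC') (krausTensor K K') hKK
    (hτ.kronecker hτ') (hZ.kronecker hZ')
    (by rw [powTr_kronecker hτ.posSemidef hτ'.posSemidef, h1, h1', mul_one])
    (by
      rw [mpow_kronecker hτ.posSemidef hτ'.posSemidef, mpow_kronecker hZ.posSemidef hZ'.posSemidef,
        krausMap_kronecker, h2, h2', smul_kronecker, kronecker_smul, smul_smul,
        ← Complex.ofReal_mul, Real.mul_rpow hC.le hC'.le])
    (by
      rw [mpow_kronecker hτ.posSemidef hτ'.posSemidef, mpow_kronecker hZ.posSemidef hZ'.posSemidef,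
        krausAdjoint_kronecker, h3, h3', smul_kronecker, kronecker_smul, smul_smul,
        ← Complex.ofReal_mul, Real.mul_rpow hC.le hC'.le])
    hsσ hs1 (PosDef.ne_zero (krausMap_posDef _ hKK hsσ))
  rw [krausMap_smul, powTr_smul (krausMap_posSemidef _ hσ.posSemidef) hs.le, hsα] at key
  have hpos2 : 0 < powTr γ σ ^ (1 / p / γ) :=
    Real.rpow_pos_of_pos (powTr_pos hσ.posSemidef hne γ) _
  rwa [inv_mul_eq_div, le_div_iff₀ hpos2] at key

theorem nonempty_of_lt_powTr {s : ℝ} {A : Matrix n n ℂ} (hA : A.PosSemidef) (h : 0 < powTr s A) :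
    Nonempty n := by
  by_contra hn
  rw [not_nonempty_iff] at hn
  obtain ⟨U, d, h'⟩ := exists_isSpectral hA.isHermitian
  rw [h'.powTr] at h
  simp at h

theorem posSemidef_add_smul_one {σ : Matrix n n ℂ} (hσ : σ.PosSemidef) {ε : ℝ} (hε : 0 < ε) :
    (σ + (ε : ℂ) • 1).PosDef := by
  have : ((ε : ℂ) • (1 : Matrix n n ℂ)).PosDef :=
    PosDef.one.smul (by exact_mod_cast hε)
  exact this.posSemidef_add hσ

open Filter Topology in
theorem tendsto_powTr_krausMap_add_smul_one {s : ℝ} (hs : 0 < s) (hs1 : s ≤ 1)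
    (K : b → Matrix a n ℂ) {σ : Matrix a a ℂ} (hσ : σ.PosSemidef) :
    Tendsto (fun ε : ℝ => powTr s (krausMap K (σ + (ε : ℂ) • 1))) (𝓝[>] 0)
      (𝓝 (powTr s (krausMap K σ))) := by
  have hKc : Continuous fun ε : ℝ => krausMap K (σ + (ε : ℂ) • 1) := by
    unfold krausMap
    fun_prop
  have h1 : ContinuousWithinAt (powTr s) {A | A.PosSemidef} (krausMap K (σ + ((0 : ℝ) : ℂ) • 1)) :=
    continuousOn_powTr hs hs1 _ (by
      simpa using krausMap_posSemidef K hσ)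
  have h2 : Tendsto (fun ε : ℝ => krausMap K (σ + (ε : ℂ) • 1)) (𝓝[>] 0)
      (𝓝[{A | A.PosSemidef}] (krausMap K (σ + ((0 : ℝ) : ℂ) • 1))) :=
    tendsto_nhdsWithin_of_tendsto_nhds_of_eventually_within _
      ((hKc.tendsto 0).mono_left nhdsWithin_le_nhds)
      (eventually_nhdsWithin_of_forall fun ε hε =>
        krausMap_posSemidef K (posSemidef_add_smul_one hσ hε).posSemidef)
  have h3 := h1.tendsto.comp h2
  simpa [Function.comp_def] using h3

/-- Lets the limit statement for `krausMap` also cover the denominator `Tr σ^s`. -/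
theorem powTr_eq_powTr_krausMap_one (s : ℝ) (A : Matrix a a ℂ) :
    powTr s A = powTr s (krausMap (fun _ : Unit => (1 : Matrix a a ℂ)) A) := by
  simp [krausMap]

open Filter Topology in
/-- Multiplicativity of the minimum of `Tr Φ(σ)^α / Tr σ^α` for `1/2 ≤ α < 1`. -/
theorem mul_mul_le_powTr_krausTensor [Nonempty a] [Nonempty a'] {p c c' : ℝ} (hp : 1 < p)
    (hp2 : p ≤ 2) (hc : 0 ≤ c) (hc' : 0 ≤ c') (K : b → Matrix a n ℂ) (K' : b' → Matrix a' n' ℂ)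
    (hK : (krausMap K 1).PosDef) (hK' : (krausMap K' 1).PosDef)
    (hmin : ∀ σ : Matrix a a ℂ, σ.PosSemidef →
      c * powTr (1 / p) σ ≤ powTr (1 / p) (krausMap K σ))
    (hmin' : ∀ σ : Matrix a' a' ℂ, σ.PosSemidef →
      c' * powTr (1 / p) σ ≤ powTr (1 / p) (krausMap K' σ))
    {σ : Matrix (a × a') (a × a') ℂ} (hσ : σ.PosSemidef) :
    c * c' * powTr (1 / p) σ ≤ powTr (1 / p) (krausMap (krausTensor K K') σ) := by
  have hα : 0 < 1 / p := by positivity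
  have hα1 : 1 / p < 1 := (div_lt_one (by linarith)).2 hp
  have hnn := powTr_nonneg (krausMap_posSemidef (krausTensor K K') hσ) (1 / p)
  rcases hc.eq_or_lt with rfl | hc
  · simpa using hnn
  rcases hc'.eq_or_lt with rfl | hc'
  · simpa using hnn
  -- The Kraus index is empty for the zero map; a positive constant `c` rules this out.
  have hn : Nonempty n := nonempty_of_lt_powTr (krausMap_posSemidef K PosSemidef.one)
    (lt_of_lt_of_le (mul_pos hc (powTr_pos PosSemidef.one (PosDef.ne_zero PosDef.one) _)) (hmin 1 PosSemidef.one))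
  have hn' : Nonempty n' := nonempty_of_lt_powTr (krausMap_posSemidef K' PosSemidef.one)
    (lt_of_lt_of_le (mul_pos hc' (powTr_pos PosSemidef.one (PosDef.ne_zero PosDef.one) _)) (hmin' 1 PosSemidef.one))
  set d : ℝ := (Fintype.card a : ℝ) with hd
  set d' : ℝ := (Fintype.card a' : ℝ) with hd'
  have hd0 : 0 < d := by rw [hd]; exact_mod_cast Fintype.card_pos
  have hd0' : 0 < d' := by rw [hd']; exact_mod_cast Fintype.card_pos
  -- Here `θ = α / γ > 1`. The minima for `γ` are at least `c d^(1-θ)` and `c' d'^(1-θ)`, and these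
  -- losses vanish as `θ → 1`.
  have key : ∀ ρ : Matrix (a × a') (a × a') ℂ, ρ.PosDef → ∀ θ : ℝ, 1 < θ →
      c * c' * (d * d') ^ (1 - θ) * powTr (1 / p) ρ ≤
        powTr (1 / p) (krausMap (krausTensor K K') ρ) := by
    intro ρ hρ θ hθ
    set γ := 1 / p / θ with hγd
    have hγ : 0 < γ := by positivity
    have hγp : γ < 1 / p := div_lt_self hα hθ
    have hθγ : 1 / p / γ = θ := by rw [hγd]; field_simp
    obtain ⟨σ₀, h1, h2, h3⟩ := exists_min_powTr_krausMap K hα hα1.le hγ (hγp.trans hα1).le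
    obtain ⟨σ₀', h1', h2', h3'⟩ := exists_min_powTr_krausMap K' hα hα1.le hγ (hγp.trans hα1).le
    have h0 : σ₀ ≠ 0 := by rintro rfl; simp at h2
    have h0' : σ₀' ≠ 0 := by rintro rfl; simp at h2'
    have hb := powTr_rpow_le_card_mul h1 hγ hγp.le
    have hb' := powTr_rpow_le_card_mul h1' hγ hγp.le
    have hle := powTr_le_powTr_rpow hρ.posSemidef hγ hγp.le
    rw [hθγ] at h3 h3' hb hb' hle
    have hs : 0 < powTr γ σ₀ ^ θ := Real.rpow_pos_of_pos (powTr_pos h1 h0 γ) _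
    have hs' : 0 < powTr γ σ₀' ^ θ := Real.rpow_pos_of_pos (powTr_pos h1' h0' γ) _
    set C := powTr (1 / p) (krausMap K σ₀) / powTr γ σ₀ ^ θ with hC
    set C' := powTr (1 / p) (krausMap K' σ₀') / powTr γ σ₀' ^ θ with hC'
    have hlow : c * d ^ (1 - θ) ≤ C := by
      rw [hC, le_div_iff₀ hs]
      refine le_trans ?_ (hmin σ₀ h1)
      rw [mul_assoc]
      refine mul_le_mul_of_nonneg_left ?_ hc.le
      refine (mul_le_mul_of_nonneg_left hb (by positivity)).trans (le_of_eq ?_)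
      rw [← mul_assoc, ← Real.rpow_add hd0]
      simp
    have hlow' : c' * d' ^ (1 - θ) ≤ C' := by
      rw [hC', le_div_iff₀ hs']
      refine le_trans ?_ (hmin' σ₀' h1')
      rw [mul_assoc]
      refine mul_le_mul_of_nonneg_left ?_ hc'.le
      refine (mul_le_mul_of_nonneg_left hb' (by positivity)).trans (le_of_eq ?_)
      rw [← mul_assoc, ← Real.rpow_add hd0']
      simp
    have hC0 : 0 < C := lt_of_lt_of_le (by positivity) hlow
    have hC0' : 0 < C' := lt_of_lt_of_le (by positivity) hlow'
    have h5 := mul_mul_le_powTr_krausTensor_of_lt hp hp2 hγ hγp hC0 hC0' K K' hK hK' h1 h1' h0 h0'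
      (by rw [hθγ, hC, div_mul_cancel₀ _ hs.ne']) (by rw [hθγ, hC', div_mul_cancel₀ _ hs'.ne'])
      (fun σ hσ => by
        rw [hθγ, hC, div_mul_eq_mul_div, div_le_iff₀ hs]
        exact h3 σ hσ)
      (fun σ hσ => by
        rw [hθγ, hC', div_mul_eq_mul_div, div_le_iff₀ hs']
        exact h3' σ hσ) hρ
    rw [hθγ] at h5
    refine le_trans ?_ h5
    have h6 : c * c' * (d * d') ^ (1 - θ) ≤ C * C' := by
      rw [Real.mul_rpow hd0.le hd0'.le]
      calc c * c' * (d ^ (1 - θ) * d' ^ (1 - θ)) = (c * d ^ (1 - θ)) * (c' * d' ^ (1 - θ)) := by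
            ring
        _ ≤ C * C' := mul_le_mul hlow hlow' (by positivity) hC0.le
    exact mul_le_mul h6 hle (powTr_nonneg hρ.posSemidef _) (by positivity)
  have key2 : ∀ ρ : Matrix (a × a') (a × a') ℂ, ρ.PosDef →
      c * c' * powTr (1 / p) ρ ≤ powTr (1 / p) (krausMap (krausTensor K K') ρ) := by
    intro ρ hρ
    have hcont : Continuous fun θ : ℝ => c * c' * (d * d') ^ (1 - θ) * powTr (1 / p) ρ := by
      have : Continuous fun θ : ℝ => (d * d') ^ (1 - θ) :=
        Real.continuous_const_rpow (mul_pos hd0 hd0').ne' |>.comp (continuous_const.sub continuous_id)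
      fun_prop
    have ht : Tendsto (fun θ : ℝ => c * c' * (d * d') ^ (1 - θ) * powTr (1 / p) ρ) (𝓝[>] 1)
        (𝓝 (c * c' * powTr (1 / p) ρ)) := by
      have := (hcont.tendsto 1).mono_left (nhdsWithin_le_nhds (s := Set.Ioi 1))
      simpa using this
    exact le_of_tendsto ht (eventually_nhdsWithin_of_forall fun θ hθ => key ρ hρ θ hθ)
  -- A singular `σ` is the limit of the positive definite `σ + ε 1`.
  have t1 := tendsto_powTr_krausMap_add_smul_one hα hα1.le (krausTensor K K') hσ
  have t2 := tendsto_powTr_krausMap_add_smul_one hα hα1.le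
    (fun _ : Unit => (1 : Matrix (a × a') (a × a') ℂ)) hσ
  simp only [← powTr_eq_powTr_krausMap_one] at t2
  exact le_of_tendsto_of_tendsto (t2.const_mul (c * c')) t1
    (eventually_nhdsWithin_of_forall fun ε hε => key2 _ (posSemidef_add_smul_one hσ hε))

end Multiplicativity

/-! ### Schatten quasi-norms as trace powers; invariance under `X Xᴴ ↔ Xᴴ X` and transposition. -/

section Schatten

variable {m n : Type*} [Fintype m] [DecidableEq m] [Fintype n] [DecidableEq n]

theorem IsSpectral.conjTranspose_mul_self {A U : Matrix n n ℂ} {d : n → ℝ} (h : IsSpectral A U d) :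
    IsSpectral (Aᴴ * A) U (fun i => d i ^ 2) := by
  refine ⟨h.1, ?_⟩
  have h2 : diagonal (fun i => ((d i ^ 2 : ℝ) : ℂ)) =
      diagonal (fun i => (d i : ℂ)) * diagonal (fun i => (d i : ℂ)) := by
    rw [diagonal_mul_diagonal]
    simp [sq]
  rw [h.isHermitian.eq, h2, ← Matrix.mul_assoc U, ← h.mul_eq, Matrix.mul_assoc, Matrix.mul_assoc,
    ← Matrix.mul_assoc U, ← h.2]

theorem schattenNorm_eq {α : ℝ} {P : Matrix n n ℂ} (hP : P.PosSemidef) :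
    schattenNorm α P = powTr α P ^ (1 / α) := by
  obtain ⟨U, d, hd⟩ := exists_isSpectral hP.isHermitian
  have h1 := ((isSpectral_eigenvalues (isHermitian_conjTranspose_mul_self P)).funcCalc
    (fun x => √x ^ α)).trace
  have h2 := (hd.conjTranspose_mul_self.funcCalc (fun x => √x ^ α)).trace
  have h3 := h1.symm.trans h2
  rw [schattenNorm, hd.powTr, Complex.ofReal_inj.mp h3]
  congr 1
  refine Finset.sum_congr rfl fun i _ => ?_
  rw [Real.sqrt_sq (hd.nonneg hP i)]

theorem powTr_eq_sum_roots_charpoly {s : ℝ} {A : Matrix n n ℂ} (hA : A.IsHermitian) :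
    powTr s A = (A.charpoly.roots.map (fun z : ℂ => z.re ^ s)).sum := by
  rw [hA.roots_charpoly_eq_eigenvalues, (isSpectral_eigenvalues hA).powTr, Multiset.map_map]
  simp [Function.comp_def]

/-- The two characteristic polynomials agree up to powers of `X`, and the extra zero roots
contribute nothing because `0 ^ s = 0` for `s ≠ 0`. -/
theorem powTr_mul_conjTranspose_self {s : ℝ} (hs : s ≠ 0) (X : Matrix m n ℂ) :
    powTr s (X * Xᴴ) = powTr s (Xᴴ * X) := by
  rw [powTr_eq_sum_roots_charpoly (isHermitian_mul_conjTranspose_self X),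
    powTr_eq_sum_roots_charpoly (isHermitian_conjTranspose_mul_self X)]
  have h := congrArg (fun p : Polynomial ℂ => (p.roots.map (fun z : ℂ => z.re ^ s)).sum)
    (charpoly_mul_comm' X Xᴴ)
  have key : ∀ (k : ℕ) (q : Polynomial ℂ), q.Monic →
      ((Polynomial.X ^ k * q).roots.map (fun z : ℂ => z.re ^ s)).sum =
        (q.roots.map (fun z : ℂ => z.re ^ s)).sum := by
    intro k q hq
    rw [Polynomial.roots_mul (mul_ne_zero (pow_ne_zero _ Polynomial.X_ne_zero) hq.ne_zero),
      Polynomial.roots_pow, Polynomial.roots_X, Multiset.map_add, Multiset.sum_add,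
      Multiset.map_nsmul, Multiset.sum_nsmul]
    simp [Real.zero_rpow hs]
  rwa [key _ _ (charpoly_monic _), key _ _ (charpoly_monic _)] at h

theorem IsSpectral.transpose {A U : Matrix n n ℂ} {d : n → ℝ} (h : IsSpectral A U d) :
    IsSpectral Aᵀ Uᴴᵀ d := by
  have hU : (Uᴴᵀ)ᴴ = Uᵀ := by
    ext i j
    simp
  refine ⟨?_, ?_⟩
  · rw [hU, ← transpose_mul, h.1, transpose_one]
  · rw [hU, h.2, transpose_mul, transpose_mul, diagonal_transpose, ← Matrix.mul_assoc]

theorem powTr_transpose {s : ℝ} {A : Matrix n n ℂ} (hA : A.IsHermitian) :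
    powTr s Aᵀ = powTr s A := by
  obtain ⟨U, d, hd⟩ := exists_isSpectral hA
  rw [hd.powTr, hd.transpose.powTr]

end Schatten

/-! ### Entry formulas for tensor products of maps. -/

section TensorMaps

variable {a b c d : Type*} [Fintype a] [DecidableEq a] [Fintype b] [DecidableEq b]
  [Fintype c] [DecidableEq c] [Fintype d] [DecidableEq d]

theorem mapTensor_kronecker (M : Matrix a a ℂ →ₗ[ℂ] Matrix b b ℂ)
    (N : Matrix c c ℂ →ₗ[ℂ] Matrix d d ℂ) (A : Matrix a a ℂ) (C : Matrix c c ℂ) :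
    mapTensor M N (A ⊗ₖ C) = M A ⊗ₖ N C := by
  simp [mapTensor]

theorem mapTensor_single (M : Matrix a a ℂ →ₗ[ℂ] Matrix b b ℂ)
    (N : Matrix c c ℂ →ₗ[ℂ] Matrix d d ℂ) (i j : a × c) :
    mapTensor M N (single i j 1) = M (single i.1 j.1 1) ⊗ₖ N (single i.2 j.2 1) := by
  rw [← mapTensor_kronecker, single_kronecker_single, one_mul]

theorem map_apply_eq_sum (M : Matrix a a ℂ →ₗ[ℂ] Matrix b b ℂ) (A : Matrix a a ℂ) (y y' : b) :
    M A y y' = ∑ i, ∑ j, A i j * M (single i j 1) y y' := by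
  conv_lhs => rw [matrix_eq_sum_single A]
  simp only [map_sum, Matrix.sum_apply]
  refine Finset.sum_congr rfl fun i _ => Finset.sum_congr rfl fun j _ => ?_
  have : single i j (A i j) = A i j • single i j (1 : ℂ) := by simp
  rw [this, map_smul, Matrix.smul_apply, smul_eq_mul]

theorem mapTensor_apply (M : Matrix a a ℂ →ₗ[ℂ] Matrix b b ℂ) (N : Matrix c c ℂ →ₗ[ℂ] Matrix d d ℂ)
    (φ : Matrix (a × c) (a × c) ℂ) (y y' : b × d) :
    mapTensor M N φ y y' = ∑ i, ∑ j, φ i j *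
      (M (single i.1 j.1 1) y.1 y'.1 * N (single i.2 j.2 1) y.2 y'.2) := by
  rw [map_apply_eq_sum]
  simp only [mapTensor_single, kroneckerMap_apply]

theorem mapTensor_id_apply (M : Matrix a a ℂ →ₗ[ℂ] Matrix b b ℂ)
    (φ : Matrix (c × a) (c × a) ℂ) (y y' : c × b) :
    mapTensor (LinearMap.id : Matrix c c ℂ →ₗ[ℂ] Matrix c c ℂ) M φ y y' =
      ∑ i, ∑ j, φ (y.1, i) (y'.1, j) * M (single i j 1) y.2 y'.2 := by
  rw [mapTensor_apply, Fintype.sum_prod_type, Finset.sum_eq_single y.1]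
  · refine Finset.sum_congr rfl fun i _ => ?_
    rw [Fintype.sum_prod_type, Finset.sum_eq_single y'.1]
    · simp
    · intro k _ hk
      simp [hk]
    · simp
  · intro k _ hk
    simp [hk]
  · simp

end TensorMaps

/-! ### Kraus decompositions, pure states as matrices, and positivity of the Choi matrix. -/

section Kraus

variable {a b n : Type*} [Fintype a] [DecidableEq a] [Fintype b] [DecidableEq b]
  [Fintype n] [DecidableEq n]
variable {a' b' n' : Type*} [Fintype a'] [DecidableEq a'] [Fintype b'] [DecidableEq b']
  [Fintype n'] [DecidableEq n']

/-- `K` is a Kraus decomposition of `M`: the Choi matrix of `M` is `V Vᴴ` where the rows of `V`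
are listed by the output index. -/
def IsKraus (M : Matrix a a ℂ →ₗ[ℂ] Matrix b b ℂ) (K : b → Matrix a n ℂ) : Prop :=
  ∀ i j y y', M (single i j 1) y y' = ∑ m, K y i m * star (K y' j m)

theorem IsKraus.mapTensor {M : Matrix a a ℂ →ₗ[ℂ] Matrix b b ℂ} {K : b → Matrix a n ℂ}
    {M' : Matrix a' a' ℂ →ₗ[ℂ] Matrix b' b' ℂ} {K' : b' → Matrix a' n' ℂ}
    (h : IsKraus M K) (h' : IsKraus M' K') :
    IsKraus (mapTensor M M') (krausTensor K K') := by
  intro i j y y'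
  rw [mapTensor_single, kronecker_apply, h, h', Finset.sum_mul_sum, Fintype.sum_prod_type]
  refine Finset.sum_congr rfl fun m _ => Finset.sum_congr rfl fun m' _ => ?_
  simp only [krausTensor, kroneckerMap_apply, star_mul']
  ring

/-- The rank-one operator of the vector with components `S k i`. -/
def pureMatrix (S : Matrix a a ℂ) : Matrix (a × a) (a × a) ℂ :=
  of fun x y => S x.1 x.2 * star (S y.1 y.2)

theorem traceLeft_pureMatrix (S : Matrix a a ℂ) : traceLeft (pureMatrix S) = (Sᴴ * S)ᵀ := by
  ext i j
  simp [traceLeft, pureMatrix, Matrix.mul_apply, mul_comm]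

theorem trace_pureMatrix (S : Matrix a a ℂ) : (pureMatrix S).trace = (Sᴴ * S).trace := by
  simp only [Matrix.trace, pureMatrix, Matrix.mul_apply, diag_apply, of_apply,
    Fintype.sum_prod_type, conjTranspose_apply]
  rw [Finset.sum_comm]
  simp only [mul_comm]

/-- The passage to the complementary map: one rectangular `X` has the output state and `Φ(Sᴴ S)` as
its two Gram matrices, so they share their nonzero spectrum. -/
theorem IsKraus.mapTensor_id_pureMatrix {M : Matrix a a ℂ →ₗ[ℂ] Matrix b b ℂ}
    {K : b → Matrix a n ℂ} (h : IsKraus M K) (S : Matrix a a ℂ) :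
    ∃ X : Matrix (a × b) n ℂ, QuantumCB.mapTensor LinearMap.id M (pureMatrix S) = X * Xᴴ ∧
      Xᴴ * X = krausMap K (Sᴴ * S) := by
  refine ⟨of fun x m => (S * K x.2) x.1 m, ?_, ?_⟩
  · ext y y'
    rw [mapTensor_id_apply]
    simp only [Matrix.mul_apply, of_apply, conjTranspose_apply, pureMatrix, h _ _ _ _, star_sum,
      Finset.mul_sum, Finset.sum_mul, star_mul']
    rw [Finset.sum_comm, Finset.sum_congr rfl fun j _ => Finset.sum_comm, Finset.sum_comm]
    refine Finset.sum_congr rfl fun m _ => Finset.sum_congr rfl fun j _ =>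
      Finset.sum_congr rfl fun i _ => ?_
    ring
  · have hy : ∀ y, (K y)ᴴ * (Sᴴ * S) * K y = (S * K y)ᴴ * (S * K y) := fun y => by
      simp only [conjTranspose_mul, Matrix.mul_assoc]
    ext m m'
    simp only [krausMap, hy, Matrix.sum_apply]
    rw [Matrix.mul_apply, Fintype.sum_prod_type, Finset.sum_comm]
    refine Finset.sum_congr rfl fun y _ => ?_
    rw [Matrix.mul_apply]
    rfl

theorem isPureState_pureMatrix {S : Matrix a a ℂ} (hS : (Sᴴ * S).trace = 1) :
    IsPureState (pureMatrix S) := by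
  have h1 : pureMatrix S = vecMulVec (fun x : a × a => S x.1 x.2) (star fun x => S x.1 x.2) := by
    ext x y
    simp [pureMatrix, vecMulVec_apply]
  have h2 : (pureMatrix S).PosSemidef := by
    rw [h1]
    exact posSemidef_vecMulVec_self_star _
  have h3 : (pureMatrix S).trace = 1 := (trace_pureMatrix S).trans hS
  refine ⟨h2, h3, le_antisymm ?_ ?_⟩
  · rw [h1]
    exact rank_vecMulVec_le _ _
  · rw [h2.isHermitian.rank_eq_card_non_zero_eigs, Nat.one_le_iff_ne_zero, ← Nat.pos_iff_ne_zero,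
      Fintype.card_pos_iff]
    by_contra hne
    have h4 : ∀ i, h2.isHermitian.eigenvalues i = 0 := fun i => by
      by_contra hi
      exact hne ⟨⟨i, hi⟩⟩
    have h5 := (isSpectral_eigenvalues h2.isHermitian).trace
    rw [h3] at h5
    simp [h4] at h5

theorem IsPureState.exists_pureMatrix {φ : Matrix (a × a) (a × a) ℂ} (hφ : IsPureState φ) :
    ∃ S : Matrix a a ℂ, φ = pureMatrix S := by
  obtain ⟨h1, -, h2⟩ := hφ
  rw [h1.isHermitian.rank_eq_card_non_zero_eigs, Fintype.card_eq_one_iff] at h2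
  obtain ⟨⟨i, hi⟩, hu⟩ := h2
  have hd := isSpectral_eigenvalues h1.isHermitian
  have hn := hd.nonneg h1
  set d := h1.isHermitian.eigenvalues
  set U : Matrix (a × a) (a × a) ℂ := (h1.isHermitian.eigenvectorUnitary : Matrix (a × a) (a × a) ℂ)
  have hz : ∀ j, j ≠ i → d j = 0 := fun j hj => by
    by_contra h0
    exact hj (congrArg Subtype.val (hu ⟨j, h0⟩))
  refine ⟨of fun k j => (√(d i) : ℂ) * U (k, j) i, ?_⟩
  ext x y
  have hs : (√(d i) : ℂ) * √(d i) = d i := by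
    rw [← Complex.ofReal_mul, Real.mul_self_sqrt (hn i)]
  rw [hd.2, Matrix.mul_apply, Finset.sum_eq_single i]
  · simp only [mul_diagonal, conjTranspose_apply, pureMatrix, of_apply, star_mul', ← hs]
    simp only [RCLike.star_def, Complex.conj_ofReal, Prod.mk.eta]
    ring
  · intro j _ hj
    simp [mul_diagonal, hz j hj]
  · simp

/-- The order is generated by elements `star W * W`, and flattening block indices turns these into
`Wᴴ W` for ordinary matrices. -/
theorem posSemidef_of_cstarMatrix_nonneg {N : CStarMatrix a a (Matrix b b ℂ)} (hN : 0 ≤ N) :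
    (of fun x y : a × b => N x.1 y.1 x.2 y.2).PosSemidef := by
  rw [StarOrderedRing.nonneg_iff] at hN
  induction hN using AddSubmonoid.closure_induction with
  | mem s hs =>
    obtain ⟨W, rfl⟩ := hs
    have : (of fun x y : a × b => (star W * W) x.1 y.1 x.2 y.2) =
        (of fun x y : a × b => W x.1 y.1 x.2 y.2)ᴴ * (of fun x y : a × b => W x.1 y.1 x.2 y.2) := by
      ext x y
      simp only [of_apply, CStarMatrix.mul_apply, CStarMatrix.star_apply, Matrix.sum_apply, Matrix.mul_apply,
        Matrix.star_apply, conjTranspose_apply, Fintype.sum_prod_type]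
    rw [this]
    exact posSemidef_conjTranspose_mul_self _
  | zero => exact PosSemidef.zero
  | add s t _ _ hs ht => exact hs.add ht

theorem choi_posSemidef (M : Matrix a a ℂ →CP Matrix b b ℂ) :
    (of fun x y : a × b => M (single x.1 y.1 1) x.2 y.2).PosSemidef := by
  rcases isEmpty_or_nonempty a with _ | ⟨⟨i₀⟩⟩
  · convert PosSemidef.zero
    ext x
    exact isEmptyElim x.1
  set E : CStarMatrix a a (Matrix a a ℂ) := CStarMatrix.ofMatrix (of fun i j => single i j (1 : ℂ))
  have hE : 0 ≤ E := by
    -- A block matrix supported on row `i₀`, with `star W * W` the block matrix of matrix units.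
    set W : CStarMatrix a a (Matrix a a ℂ) :=
      CStarMatrix.ofMatrix (of fun i j => if i = i₀ then single i₀ j (1 : ℂ) else 0)
    have : E = star W * W := by
      ext i j : 2
      rw [CStarMatrix.mul_apply, Finset.sum_eq_single i₀]
      · simp [E, W, CStarMatrix.star_apply, star_eq_conjTranspose]
      · intro k _ hk
        simp [W, hk]
      · simp
    rw [this]
    exact star_mul_self_nonneg W
  exact posSemidef_of_cstarMatrix_nonneg (M.map_cstarMatrix_nonneg E hE)

end Kraus

/-! ### The quasi-norm as a minimum over density matrices. -/

section QuasiNorm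

universe u v

/-- Scaled eigenvectors of the Choi matrix serve as columns. Keeping only positive eigenvalues makes
`Φ(1)` the diagonal matrix of those eigenvalues, hence invertible. -/
theorem exists_isKraus {a : Type u} {b : Type v} [Fintype a] [DecidableEq a] [Fintype b]
    [DecidableEq b] (M : Matrix a a ℂ →CP Matrix b b ℂ) :
    ∃ (n : Type (max u v)) (_ : Fintype n) (_ : DecidableEq n) (K : b → Matrix a n ℂ),
      IsKraus M.toLinearMap K ∧ (krausMap K 1).PosDef := by
  obtain ⟨J, hJ, hJM⟩ : ∃ J : Matrix (a × b) (a × b) ℂ, J.PosSemidef ∧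
      ∀ i j y y', M.toLinearMap (single i j 1) y y' = J (i, y) (j, y') :=
    ⟨_, choi_posSemidef M, fun _ _ _ _ => rfl⟩
  have hd := isSpectral_eigenvalues hJ.isHermitian
  have hn := hd.nonneg hJ
  set d := hJ.isHermitian.eigenvalues
  set U : Matrix (a × b) (a × b) ℂ := (hJ.isHermitian.eigenvectorUnitary : Matrix (a × b) (a × b) ℂ)
  refine ⟨{m // 0 < d m}, inferInstance, inferInstance,
    fun y => of fun i m => (√(d m) : ℂ) * U (i, y) m, fun i j y y' => ?_, ?_⟩
  · have h2 : ∀ m, (√(d m) : ℂ) * √(d m) = d m := fun m => by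
      rw [← Complex.ofReal_mul, Real.mul_self_sqrt (hn m)]
    have h3 : ∀ m, ((√(d m) : ℂ) * U (i, y) m) * star ((√(d m) : ℂ) * U (j, y') m) =
        U (i, y) m * d m * star (U (j, y') m) := fun m => by
      rw [← h2 m, star_mul']
      simp only [RCLike.star_def, Complex.conj_ofReal]
      ring
    rw [hJM, hd.2, Matrix.mul_apply]
    simp only [of_apply, h3, mul_diagonal, conjTranspose_apply]
    rw [← Finset.sum_subtype (Finset.univ.filter fun m => 0 < d m) (by simp)
      (fun m => U (i, y) m * d m * star (U (j, y') m)), Finset.sum_filter_of_ne]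
    intro m _ hm
    refine lt_of_le_of_ne (hn m) fun h0 => hm ?_
    simp [← h0]
  · have h1 : krausMap (fun y => of fun i (m : {m // 0 < d m}) => (√(d m) : ℂ) * U (i, y) m) 1 =
        diagonal fun m : {m // 0 < d m} => (d m : ℂ) := by
      ext m m'
      have h2 : (Uᴴ * U) m m' = (1 : Matrix (a × b) (a × b) ℂ) m m' := by rw [hd.1]
      rw [Matrix.mul_apply, Fintype.sum_prod_type, Finset.sum_comm] at h2
      simp only [krausMap, Matrix.mul_one, Matrix.sum_apply, Matrix.mul_apply, of_apply,
        conjTranspose_apply, star_mul', RCLike.star_def, Complex.conj_ofReal] at h2 ⊢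
      have h3 : ∀ y i, (√(d m) : ℂ) * (starRingEnd ℂ) (U (i, y) m) * (√(d m') * U (i, y) m') =
          (√(d m) : ℂ) * √(d m') * ((starRingEnd ℂ) (U (i, y) m) * U (i, y) m') := fun y i => by
        ring
      simp only [h3, ← Finset.mul_sum, h2]
      by_cases hm : m = m'
      · subst hm
        rw [one_apply_eq, diagonal_apply_eq, mul_one, ← Complex.ofReal_mul,
          Real.mul_self_sqrt (hn m)]
      · rw [one_apply_ne (fun h => hm (Subtype.ext h)), diagonal_apply_ne _ hm, mul_zero]
    rw [h1]
    exact PosDef.diagonal fun m => by exact_mod_cast m.2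

variable {a b n : Type*} [Fintype a] [DecidableEq a] [Fintype b] [DecidableEq b]
  [Fintype n] [DecidableEq n]

/-- Every density matrix is `Sᴴ S` for some `S`, so pure states and density matrices `σ` produce the
same ratios. -/
theorem mem_cbRatios_iff {M : Matrix a a ℂ →ₗ[ℂ] Matrix b b ℂ} {K : b → Matrix a n ℂ}
    (h : IsKraus M K) {α : ℝ} (hα : α ≠ 0) (r : ℝ) :
    r ∈ cbRatios α M ↔ ∃ σ : Matrix a a ℂ, σ.PosSemidef ∧ σ.trace = 1 ∧
      r = powTr α (krausMap K σ) ^ (1 / α) / powTr α σ ^ (1 / α) := by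
  have key : ∀ S : Matrix a a ℂ,
      schattenNorm α (mapTensor (LinearMap.id : Matrix a a ℂ →ₗ[ℂ] Matrix a a ℂ) M (pureMatrix S)) /
        schattenNorm α (traceLeft (pureMatrix S)) =
      powTr α (krausMap K (Sᴴ * S)) ^ (1 / α) / powTr α (Sᴴ * S) ^ (1 / α) := fun S => by
    obtain ⟨X, h1, h2⟩ := h.mapTensor_id_pureMatrix S
    have hS := posSemidef_conjTranspose_mul_self S
    rw [h1, schattenNorm_eq (posSemidef_self_mul_conjTranspose X), powTr_mul_conjTranspose_self hα,
      h2, traceLeft_pureMatrix, schattenNorm_eq hS.transpose, powTr_transpose hS.isHermitian]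
  constructor
  · rintro ⟨φ, hφ, rfl⟩
    obtain ⟨S, rfl⟩ := hφ.exists_pureMatrix
    exact ⟨Sᴴ * S, posSemidef_conjTranspose_mul_self S, (trace_pureMatrix S).symm.trans hφ.2.1, key S⟩
  · rintro ⟨σ, hσ, h1, rfl⟩
    obtain ⟨S, rfl⟩ := CStarAlgebra.nonneg_iff_eq_star_mul_self.mp hσ.nonneg
    exact ⟨pureMatrix S, isPureState_pureMatrix h1, (key S).symm⟩

theorem IsKraus.exists_isLeast_cbRatios [Nonempty a] {M : Matrix a a ℂ →ₗ[ℂ] Matrix b b ℂ}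
    {K : b → Matrix a n ℂ} (h : IsKraus M K) {α : ℝ} (hα : 0 < α) (hα1 : α ≤ 1) :
    ∃ (c : ℝ) (σ₀ : Matrix a a ℂ), 0 ≤ c ∧ σ₀.PosSemidef ∧ 0 < powTr α σ₀ ∧
      powTr α (krausMap K σ₀) = c * powTr α σ₀ ∧
      (∀ σ : Matrix a a ℂ, σ.PosSemidef → c * powTr α σ ≤ powTr α (krausMap K σ)) ∧
      IsLeast (cbRatios α M) (c ^ (1 / α)) := by
  obtain ⟨σ₀, h0, ht, hmin⟩ := exists_min_powTr_krausMap K hα hα1 hα hα1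
  have hpos : ∀ σ : Matrix a a ℂ, σ.PosSemidef → σ.trace = 1 → 0 < powTr α σ := fun σ hσ h1 =>
    powTr_pos hσ (fun hz => by simp [hz] at h1) α
  have hp := hpos σ₀ h0 ht
  have hK := fun (σ : Matrix a a ℂ) (hσ : σ.PosSemidef) =>
    powTr_nonneg (krausMap_posSemidef K hσ) α
  have hle : ∀ σ : Matrix a a ℂ, σ.PosSemidef →
      powTr α (krausMap K σ₀) / powTr α σ₀ * powTr α σ ≤ powTr α (krausMap K σ) := fun σ hσ => by
    have := hmin σ hσ
    rw [div_self hα.ne', Real.rpow_one, Real.rpow_one] at this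
    rwa [div_mul_eq_mul_div, div_le_iff₀ hp]
  refine ⟨powTr α (krausMap K σ₀) / powTr α σ₀, σ₀, div_nonneg (hK _ h0) hp.le, h0, hp,
    (div_mul_cancel₀ _ hp.ne').symm, hle, ?_, ?_⟩
  · rw [mem_cbRatios_iff h hα.ne']
    exact ⟨σ₀, h0, ht, Real.div_rpow (hK _ h0) hp.le _⟩
  · intro r hr
    obtain ⟨σ, hσ, h1, rfl⟩ := (mem_cbRatios_iff h hα.ne' r).1 hr
    have hq := hpos σ hσ h1
    rw [← Real.div_rpow (hK _ hσ) hq.le]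
    exact Real.rpow_le_rpow (div_nonneg (hK _ h0) hp.le) ((le_div_iff₀ hq).2 (hle σ hσ))
      (by positivity)

end QuasiNorm

end QuantumCB

theorem theorem1 {a₁ a₂ b₁ b₂ : Type*}
    [Fintype a₁] [DecidableEq a₁] [Nonempty a₁] [Fintype a₂] [DecidableEq a₂] [Nonempty a₂]
    [Fintype b₁] [DecidableEq b₁] [Fintype b₂] [DecidableEq b₂]
    (M₁ : Matrix a₁ a₁ ℂ →CP Matrix b₁ b₁ ℂ) (M₂ : Matrix a₂ a₂ ℂ →CP Matrix b₂ b₂ ℂ)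
    (α : ℝ) (hα : α ∈ Set.Ico (1 / 2 : ℝ) 1) :
    IsLeast (QuantumCB.cbRatios α M₁.toLinearMap) (QuantumCB.cbQuasiNorm α M₁.toLinearMap) ∧
    IsLeast (QuantumCB.cbRatios α M₂.toLinearMap) (QuantumCB.cbQuasiNorm α M₂.toLinearMap) ∧
    IsLeast (QuantumCB.cbRatios α (QuantumCB.mapTensor M₁.toLinearMap M₂.toLinearMap))
      (QuantumCB.cbQuasiNorm α (QuantumCB.mapTensor M₁.toLinearMap M₂.toLinearMap)) ∧
    QuantumCB.cbQuasiNorm α (QuantumCB.mapTensor M₁.toLinearMap M₂.toLinearMap) =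
      QuantumCB.cbQuasiNorm α M₁.toLinearMap * QuantumCB.cbQuasiNorm α M₂.toLinearMap := by
  obtain ⟨n₁, _, _, K₁, hK₁, hP₁⟩ := QuantumCB.exists_isKraus M₁
  obtain ⟨n₂, _, _, K₂, hK₂, hP₂⟩ := QuantumCB.exists_isKraus M₂
  obtain ⟨hα2, hα1⟩ := hα
  have hα0 : 0 < α := by linarith
  obtain ⟨c₁, σ₁, hc₁, hσ₁, hp₁, he₁, hm₁, hl₁⟩ := hK₁.exists_isLeast_cbRatios hα0 hα1.le
  obtain ⟨c₂, σ₂, hc₂, hσ₂, hp₂, he₂, hm₂, hl₂⟩ := hK₂.exists_isLeast_cbRatios hα0 hα1.le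
  obtain ⟨c, σ, hc, hσ, hp, he, hm, hl⟩ :=
    (hK₁.mapTensor hK₂).exists_isLeast_cbRatios hα0 hα1.le
  have h1α : 1 / (1 / α) = α := one_div_one_div α
  -- Here `p = 1/α`, and `α ≥ 1/2` is exactly `p ≤ 2`, the range of Ando's theorem.
  have hge : c₁ * c₂ ≤ c := by
    have h := QuantumCB.mul_mul_le_powTr_krausTensor (p := 1 / α) ((lt_div_iff₀ hα0).2 (by linarith))
      ((div_le_iff₀ hα0).2 (by linarith)) hc₁ hc₂ K₁ K₂ hP₁ hP₂ (by rwa [h1α]) (by rwa [h1α]) hσ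
    rw [h1α, he] at h
    exact le_of_mul_le_mul_right h hp
  -- The product of the two minimisers is a competitor.
  have hle : c ≤ c₁ * c₂ := by
    have h := hm _ (hσ₁.kronecker hσ₂)
    rw [QuantumCB.krausMap_kronecker, QuantumCB.powTr_kronecker hσ₁ hσ₂,
      QuantumCB.powTr_kronecker (QuantumCB.krausMap_posSemidef K₁ hσ₁)
        (QuantumCB.krausMap_posSemidef K₂ hσ₂), he₁, he₂, mul_mul_mul_comm] at h
    exact le_of_mul_le_mul_right h (mul_pos hp₁ hp₂)
  simp only [QuantumCB.cbQuasiNorm, hl₁.csInf_eq, hl₂.csInf_eq, hl.csInf_eq]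
  exact ⟨hl₁, hl₂, hl, by rw [le_antisymm hle hge, Real.mul_rpow hc₁ hc₂]⟩
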